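/- An error structure is a tuple $(\Omega,\mathcal A,\mathbb P,\mathbb D,\Gamma)$ where $(\Omega,\mathcal A,\mathbb P)$ is a probability space, $\mathbb D$ is a dense subspace of $L^2(\mathbb P)$ with $1\in\mathbb D$, and $\Gamma:\mathbb D\times\mathbb D\to L^1(\mathbb P)$ is a positive symmetric bilinear operator such that (a) for $U\in\mathbb D^m$, $V\in\mathbb D^n$ and $F,G$ of class $C^1$ and Lipschitz one has $F(U),G(V)\in\mathbb D$ and $\Gamma[F(U),G(V)]=\sum_{i,j}F_i'(U)G_j'(V)\Gamma[U_i,V_j]$ a.s., and (b) $\mathbb D$ is complete for the norm $(\|\cdot\|_{L^2}^2+\mathcal E[\cdot])^{1/2}$, where $\mathcal E[f]=\frac12\int\Gamma[f]\,d\mathbb P$ and $\Gamma[f]=\Gamma[f,f]$. Let $(\mathbb R,\mathcal B(\mathbb R),\mu,\mathbf d,\gamma)$ be an error structure such that the identity $j$ belongs to $\mathbf d$ and $\int j\,d\mu=0$. Put $\sigma^2=\int j^2\,d\mu$ and $c=\int\gamma[j]\,d\mu$. Let $(\Omega,\mathcal A,\mathbb P,\mathbb D,\Gamma)=(\mathbb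 R,\mathcal B(\mathbb R),\mu,\mathbf d,\gamma)^{\mathbb N^*}$ be the product structure: $\mathbb P=\mu^{\otimes\mathbb N^*}$, $\mathbb D$ is the set of $f\in L^2(\mathbb P)$ such that for every $n$ and almost all values of the other coordinates, $f$ as a function of its $n$-th coordinate belongs to $\mathbf d$, with $\int\sum_n\gamma_n[f]\,d\mathbb P<\infty$ ($\gamma_n$ being $\gamma$ acting on the $n$-th coordinate), and $\Gamma[f,h]=\sum_n\gamma_n[f,h]$. Let $U_1,U_2,\dots$ be the coordinate maps and, for $n\ge1$ and $t\in[0,1]$, $$X_n(t)=\frac1{\sqrt n}\Big(\sum_{k=1}^{[nt]}U_k+(nt-[nt])U_{[nt]+1}\Big).$$ Let $W=C([0,1])$, let $m$ be the Wiener measure on $W$ under which the coordinate process $B$ is a centered Brownian motion with $B(t)$ of variance $\sigma^2t$, and let $(W,\mathcal B(W),m,\mathbb D_0,\Gamma_0)$ be the Ornstein–Uhlenbeck structure normalized by $\Gamma_0[\int_0^1h\,dB]=c\int_0^1h^2\,dt$, that is, the closure of the form defined on the functions $\varphi(B(s_1),\dots,B(s_q))$, $\varphi\in C^1\cap\mathrm{Lip}$,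 by $\Gamma_0[B(s),B(s')]=c\,(s\wedge s')$ and the functional calculus (a). Then for all $t_1,\dots,t_p\in[0,1]$ the random vectors $(X_n(t_1),\dots,X_n(t_p))$ converge in Dirichlet law to $(B(t_1),\dots,B(t_p))$. That is, $(W,\mathcal B(W),m,\mathbb D_0,\Gamma_0)$ is an error structure, the laws of $(X_n(t_1),\dots,X_n(t_p))$ under $\mathbb P$ converge weakly to the law of $(B(t_1),\dots,B(t_p))$ under $m$, and for every $f:\mathbb R^p\to\mathbb R$ of class $C^1$ and Lipschitz one has $f(X_n(t_1),\dots,X_n(t_p))\in\mathbb D$ for all $n\geq 1$, $f(B(t_1),\dots,B(t_p))\in\mathbb D_0$ and $$\mathcal E[f(X_n(t_1),\dots,X_n(t_p))]\to\mathcal E_0[f(B(t_1),\dots,B(t_p))],\qquad \mathcal E_0[g]=\tfrac12\int\Gamma_0[g]\,dm .$$ Explicitly, $$\mathbb E\,\Gamma[f(X_n(t_1),\dots,X_n(t_p))]\to\mathbb E\Big[\sum_{i,j=1}^pf_i'(B(t_1),\dots,B(t_p))f_j'(B(t_1),\dots,B(t_p))\,c\,(t_i\wedge t_j)\Big].$$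 -/

import Mathlib

open MeasureTheory ProbabilityTheory Filter Topology

noncomputable section

/-- Functions of class `C¹ ∩ Lip` from a real normed space to `ℝ`. -/
def IsC1Lip {E : Type*} [NormedAddCommGroup E] [NormedSpace ℝ E] (F : E → ℝ) : Prop :=
  ContDiff ℝ 1 F ∧ ∃ K : NNReal, LipschitzWith K F

/-- The `i`-th partial derivative of a function on `ℝ^m`. -/
def partialDeriv {m : ℕ} (F : (Fin m → ℝ) → ℝ) (i : Fin m) (x : Fin m → ℝ) : ℝ :=
  fderiv ℝ F x (Pi.single i 1)

/-- The data `(Ω, 𝒜, P, 𝔻, Γ)` of an error structure.  Elements of `𝔻 ⊆ L²(P)` and the values of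
`Γ` in `L¹(P)` are represented by functions, which matter only up to `P`-a.e. equality; the axioms
are in `ErrorData.IsErrorStructure`. -/
structure ErrorData (Ω : Type*) [MeasurableSpace Ω] where
  /-- the probability measure -/
  P : Measure Ω
  isProb : IsProbabilityMeasure P
  /-- the domain `𝔻` -/
  Dom : Set (Ω → ℝ)
  /-- the squared field operator, only meaningful on `𝔻 × 𝔻` -/
  Γ : (Ω → ℝ) → (Ω → ℝ) → Ω → ℝ

namespace ErrorData

instance {Ω : Type*} [MeasurableSpace Ω] (S : ErrorData Ω) : IsProbabilityMeasure S.P := S.isProb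

/-- The form `ℰ[f] = ½ ∫ Γ[f, f] dP`. -/
def energy {Ω : Type*} [MeasurableSpace Ω] (S : ErrorData Ω) (f : Ω → ℝ) : ℝ :=
  (1 / 2) * ∫ ω, S.Γ f f ω ∂S.P

/-- The axioms of an error structure: `𝔻` is a dense subspace of `L²(P)` containing `1`, `Γ` is a
symmetric positive bilinear operator from `𝔻 × 𝔻` to `L¹(P)` with the functional calculus of class
`C¹ ∩ Lip`, and `𝔻` is complete for `(‖·‖²_{L²} + ℰ[·])^{1/2}`. -/
structure IsErrorStructure {Ω : Type*} [MeasurableSpace Ω] (S : ErrorData Ω) : Prop where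
  memLp : ∀ f ∈ S.Dom, MemLp f 2 S.P
  dom_congr : ∀ f ∈ S.Dom, ∀ g : Ω → ℝ, f =ᵐ[S.P] g → g ∈ S.Dom
  dom_add : ∀ f ∈ S.Dom, ∀ g ∈ S.Dom, f + g ∈ S.Dom
  dom_smul : ∀ (a : ℝ), ∀ f ∈ S.Dom, a • f ∈ S.Dom
  dense : ∀ f : Ω → ℝ, MemLp f 2 S.P → ∀ ε : ENNReal, 0 < ε →
    ∃ g ∈ S.Dom, eLpNorm (f - g) 2 S.P < ε
  gamma_integrable : ∀ f ∈ S.Dom, ∀ g ∈ S.Dom, Integrable (S.Γ f g) S.P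
  gamma_congr : ∀ f ∈ S.Dom, ∀ f' ∈ S.Dom, ∀ g ∈ S.Dom, f =ᵐ[S.P] f' →
    S.Γ f g =ᵐ[S.P] S.Γ f' g
  gamma_symm : ∀ f ∈ S.Dom, ∀ g ∈ S.Dom, S.Γ f g =ᵐ[S.P] S.Γ g f
  gamma_add : ∀ f ∈ S.Dom, ∀ g ∈ S.Dom, ∀ h ∈ S.Dom,
    S.Γ (f + g) h =ᵐ[S.P] S.Γ f h + S.Γ g h
  gamma_smul : ∀ (a : ℝ), ∀ f ∈ S.Dom, ∀ g ∈ S.Dom, S.Γ (a • f) g =ᵐ[S.P] a • S.Γ f g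
  gamma_nonneg : ∀ f ∈ S.Dom, 0 ≤ᵐ[S.P] S.Γ f f
  calculus_mem : ∀ (m : ℕ) (U : Fin m → Ω → ℝ) (F : (Fin m → ℝ) → ℝ), (∀ i, U i ∈ S.Dom) →
    IsC1Lip F → (fun ω => F fun i => U i ω) ∈ S.Dom
  calculus_gamma : ∀ (m n : ℕ) (U : Fin m → Ω → ℝ) (V : Fin n → Ω → ℝ) (F : (Fin m → ℝ) → ℝ)
    (G : (Fin n → ℝ) → ℝ), (∀ i, U i ∈ S.Dom) → (∀ j, V j ∈ S.Dom) → IsC1Lip F → IsC1Lip G →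
    S.Γ (fun ω => F fun i => U i ω) (fun ω => G fun j => V j ω) =ᵐ[S.P]
      fun ω => ∑ i, ∑ j, partialDeriv F i (fun i => U i ω) * partialDeriv G j (fun j => V j ω) *
        S.Γ (U i) (V j) ω
  one_mem : (fun _ => 1) ∈ S.Dom
  complete : ∀ u : ℕ → Ω → ℝ, (∀ k, u k ∈ S.Dom) →
    Tendsto (fun q : ℕ × ℕ => eLpNorm (u q.1 - u q.2) 2 S.P) (atTop ×ˢ atTop) (𝓝 0) →
    Tendsto (fun q : ℕ × ℕ => S.energy (u q.1 - u q.2)) (atTop ×ˢ atTop) (𝓝 0) →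
    ∃ f ∈ S.Dom, Tendsto (fun k => eLpNorm (u k - f) 2 S.P) atTop (𝓝 0) ∧
      Tendsto (fun k => S.energy (u k - f)) atTop (𝓝 0)

/-- Convergence in Dirichlet law of the random variables `U n`, defined on the space of `S`, to the
random variable `V` defined on the space of an error structure `S₀`: weak convergence of the laws,
and convergence of the energies of `F (U n)` to the energy of `F (V)` for all `F ∈ C¹ ∩ Lip`. -/
structure ConvergesInDirichletLaw {Ω Ω₀ E : Type*} [MeasurableSpace Ω] [MeasurableSpace Ω₀]
    [NormedAddCommGroup E] [NormedSpace ℝ E] [MeasurableSpace E] [BorelSpace E]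
    (S : ErrorData Ω) (U : ℕ → Ω → E) (S₀ : ErrorData Ω₀) (V : Ω₀ → E) : Prop where
  isErrorStructure : S₀.IsErrorStructure
  measurable_seq : ∀ n, Measurable (U n)
  measurable_lim : Measurable V
  tendsto_law : ∀ f : BoundedContinuousFunction E ℝ,
    Tendsto (fun n => ∫ ω, f (U n ω) ∂S.P) atTop (𝓝 (∫ w, f (V w) ∂S₀.P))
  mem_dom_seq : ∀ F : E → ℝ, IsC1Lip F → ∀ n, (fun ω => F (U n ω)) ∈ S.Dom
  mem_dom_lim : ∀ F : E → ℝ, IsC1Lip F → (fun w => F (V w)) ∈ S₀.Dom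
  tendsto_energy : ∀ F : E → ℝ, IsC1Lip F →
    Tendsto (fun n => S.energy fun ω => F (U n ω)) atTop (𝓝 (S₀.energy fun w => F (V w)))

/-! ### The product structure `S^ℕ` -/

section Product

variable {E : Type*} [MeasurableSpace E]

/-- The function of the `n`-th coordinate obtained from `f` by freezing the other coordinates
of `ω`. -/
def coordSection (f : (ℕ → E) → ℝ) (n : ℕ) (ω : ℕ → E) : E → ℝ :=
  fun x => f (Function.update ω n x)

/-- `g` is a jointly measurable version of `ω ↦ γ[f_n, h_n](ω n)`, where `f_n`, `h_n` are the
functions of the `n`-th coordinate obtained from `f`, `h` by freezing the other coordinates of `ω`;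
these functions are required to be in the domain of `γ` for almost all `ω`. -/
structure IsPartialGamma (S : ErrorData E) (n : ℕ) (f h g : (ℕ → E) → ℝ) : Prop where
  aesm : AEStronglyMeasurable g (Measure.infinitePi fun _ : ℕ => S.P)
  sections : ∀ᵐ ω ∂(Measure.infinitePi fun _ : ℕ => S.P),
    coordSection f n ω ∈ S.Dom ∧ coordSection h n ω ∈ S.Dom ∧
      coordSection g n ω =ᵐ[S.P] S.Γ (coordSection f n ω) (coordSection h n ω)

open Classical in
/-- The product `S^ℕ`: the domain consists of the `f ∈ L²(P)` whose one-coordinate sections are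
almost all in the domain of `S` and for which `∫ ∑ₙ γₙ[f] dP < ∞`, and `Γ[f, h] = ∑ₙ γₙ[f, h]`
with `γₙ` acting on the `n`-th coordinate. -/
def pow (S : ErrorData E) : ErrorData (ℕ → E) where
  P := Measure.infinitePi fun _ : ℕ => S.P
  isProb := inferInstance
  Dom := {f | MemLp f 2 (Measure.infinitePi fun _ : ℕ => S.P) ∧
    ∃ g : ℕ → (ℕ → E) → ℝ, (∀ n, S.IsPartialGamma n f f (g n)) ∧
      ∫⁻ ω, ∑' n, ENNReal.ofReal (g n ω) ∂(Measure.infinitePi fun _ : ℕ => S.P) < ⊤}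
  Γ f h := if H : ∃ g : ℕ → (ℕ → E) → ℝ, ∀ n, S.IsPartialGamma n f h (g n)
    then fun ω => ∑' n, H.choose n ω else 0

end Product

end ErrorData

/-! ### Wiener space and its Ornstein-Uhlenbeck structure -/

namespace WienerSpace

/-- The path space `W = C([0, 1])`, with its uniform norm. -/
abbrev Path : Type := C(unitInterval, ℝ)

instance : MeasurableSpace Path := borel Path

instance : BorelSpace Path := ⟨rfl⟩

/-- `m` is the Wiener measure of variance `v`: the coordinates form a centered Gaussian process
with covariance `v (s ∧ t)`, i.e. a Brownian motion `B` such that `B t` has variance `v t`. -/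
structure IsWienerMeasure (v : ℝ) (m : Measure Path) : Prop where
  isGaussian : IsGaussianProcess (fun (t : unitInterval) (w : Path) => w t) m
  mean : ∀ t : unitInterval, ∫ w : Path, w t ∂m = 0
  cov : ∀ s t : unitInterval,
    cov[fun w : Path => w s, fun w : Path => w t; m] = v * min (s : ℝ) (t : ℝ)

/-- A cylinder function `w ↦ φ (w t₁, …, w t_q)` with `φ ∈ C¹ ∩ Lip`. -/
structure Cylinder where
  /-- the number of times -/
  q : ℕ
  /-- the times -/
  t : Fin q → unitInterval
  /-- the function of the values at these times -/
  φ : (Fin q → ℝ) → ℝ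
  isC1Lip : IsC1Lip φ

/-- The values of the path at the times of the cylinder function. -/
def Cylinder.coords (a : Cylinder) (w : Path) : Fin a.q → ℝ := fun i => w (a.t i)

/-- The cylinder function as a function on the path space. -/
def Cylinder.eval (a : Cylinder) (w : Path) : ℝ := a.φ (a.coords w)

/-- The squared field operator on cylinder functions:
`Γ[φ(B_t), ψ(B_s)] = ∑ᵢⱼ φ'ᵢ(B_t) ψ'ⱼ(B_s) c (tᵢ ∧ sⱼ)`. -/
def cylGamma (c : ℝ) (a b : Cylinder) (w : Path) : ℝ :=
  ∑ i, ∑ j, partialDeriv a.φ i (a.coords w) * partialDeriv b.φ j (b.coords w) *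
    (c * min (a.t i : ℝ) (b.t j : ℝ))

/-- The cylinder functions `a k` converge to `f` in `L²(m)` and are Cauchy for the energy,
that is `∫ Γ[a k - a l] dm → 0`. -/
structure Approximates (c : ℝ) (m : Measure Path) (a : ℕ → Cylinder) (f : Path → ℝ) : Prop where
  tendsto : Tendsto (fun k => eLpNorm ((a k).eval - f) 2 m) atTop (𝓝 0)
  cauchy : Tendsto (fun r : ℕ × ℕ => ∫ w, (cylGamma c (a r.1) (a r.1) w
    - 2 * cylGamma c (a r.1) (a r.2) w + cylGamma c (a r.2) (a r.2) w) ∂m)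
    (atTop ×ˢ atTop) (𝓝 0)

/-- `g` is the value of the squared field operator at `(f, h)`: the limit in `L¹(m)` of its values
along approximating cylinder functions. -/
def IsGamma (c : ℝ) (m : Measure Path) (f h g : Path → ℝ) : Prop :=
  Integrable g m ∧ ∃ a b : ℕ → Cylinder, Approximates c m a f ∧ Approximates c m b h ∧
    Tendsto (fun k => eLpNorm (cylGamma c (a k) (b k) - g) 1 m) atTop (𝓝 0)

open Classical in
/-- The Ornstein-Uhlenbeck structure `(W, 𝒲, m, 𝔻₀, Γ₀)`, normalized by
`Γ₀[∫ h dB] = c ∫ h² dt`: the closure of the form given on cylinder functions by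
`Γ₀[B s, B t] = c (s ∧ t)` and the functional calculus. -/
def ornsteinUhlenbeck (c : ℝ) (m : Measure Path) (hm : IsProbabilityMeasure m) :
    ErrorData Path where
  P := m
  isProb := hm
  Dom := {f | MemLp f 2 m ∧ ∃ a : ℕ → Cylinder, Approximates c m a f}
  Γ f h := if H : ∃ g, IsGamma c m f h g then H.choose else 0

end WienerSpace

/-- The interpolated random walk `X_n(t) = n^{-1/2} (∑_{k=1}^{[nt]} U_k + (nt - [nt]) U_{[nt]+1})`,
where `U_k` is the coordinate of index `k - 1` of `ω`. -/
def randomWalk (n : ℕ) (t : unitInterval) (ω : ℕ → ℝ) : ℝ :=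
  1 / √(n : ℝ) * (∑ k ∈ Finset.range ⌊(n : ℝ) * t⌋₊, ω k
    + ((n : ℝ) * t - (⌊(n : ℝ) * t⌋₊ : ℝ)) * ω ⌊(n : ℝ) * t⌋₊)

end

/-! The limit structure is described by a closed gradient, the squared field operator of the random
walk by the functional calculus in each coordinate; the central limit theorem and the law of large
numbers then identify the limit of the energies.

**The limit structure.** On cylinder functions `Γ₀[φ(B_s)] = ⟪∇φ(B_s), ∇φ(B_s)⟫`, where the gradient
`∇φ(B_s) = √c ∑ᵢ φ'ᵢ(B_s) 1_{(0, sᵢ]}` takes its values in `L²(ℝ)`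
(`WienerSpace.cylGamma_eq_inner`).  The closure `IsGrad` of this gradient is single valued: Gaussian
integration by parts (`IsGaussianProcess.integral_mul_comp`) expresses the pairings of `∇f` with
`b 1_{(0, t]}`, for bounded cylinder functions `b`, through `f` alone
(`IsGrad.integral_inner_timeVec`), and bounded cylinder functions separate integrable functions
(`ae_eq_zero_of_forall_cylinder`).  Integration by parts carries the factor `σ²`, so it says nothing
if `σ² = 0`; but then the identity vanishes `μ`-almost everywhere, hence `c = 0` and the gradient is
zero.  Passing to the limit in the chain rule for cylinder functions gives it for the closed gradient
(`IsGrad.chain`), and a closed gradient with the chain rule defines an error structure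
(`ClosedGradient.isErrorStructure`).

**The product structure.** `X_n` is a vector of linear combinations of finitely many coordinates
(`randomWalk_eq_linComb`).  The functional calculus of the one-dimensional structure, applied in each
coordinate, gives `Γ[F(X_n)] = ∑ᵢⱼ F'ᵢ(X_n) F'ⱼ(X_n) ∑ₖ aᵢₖ aⱼₖ γ[j](U_k)` with
`aᵢₖ` the coefficient of `U_k` in `X_n(tᵢ)` (`ErrorData.gamma_pow_linComb`).  The definition of the
product uses an arbitrary version of the partial operators, and versions are unique because
resampling one coordinate preserves the product measure.

**The limit.** Since `∑ₖ aᵢₖ aⱼₖ → tᵢ ∧ tⱼ` and the coefficients are uniformly small, Lindeberg's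
replacement argument and Lévy's continuity theorem give the weak convergence
(`ErrorData.tendsto_integral_randomWalk`).  The law of large numbers in `L¹` gives
`∑ₖ aᵢₖ aⱼₖ γ[j](U_k) → c (tᵢ ∧ tⱼ)` (`ErrorData.tendsto_integral_abs_sum_gamma`), and as the
`F'ᵢ F'ⱼ` are bounded and continuous, the two limits combine to that of the energies.
-/

noncomputable section

open scoped RealInnerProductSpace

/-! ### Convergence in `L²` for sequences of functions -/

section LTwo

variable {Ω : Type*} [MeasurableSpace Ω] {P : Measure Ω}

theorem MeasureTheory.MemLp.toReal_eLpNorm_two_sq {H : Type*} [NormedAddCommGroup H]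
    [InnerProductSpace ℝ H] {V : Ω → H} (hV : MemLp V 2 P) :
    (eLpNorm V 2 P).toReal ^ 2 = ∫ ω, ⟪V ω, V ω⟫ ∂P := by
  rw [hV.eLpNorm_eq_integral_rpow_norm (by norm_num) (by norm_num)]
  have h0 : 0 ≤ ∫ ω, ‖V ω‖ ^ (2 : ℝ) ∂P := integral_nonneg fun ω => by positivity
  simp only [ENNReal.toReal_ofNat]
  rw [ENNReal.toReal_ofReal (by positivity), ← Real.rpow_natCast, ← Real.rpow_mul h0]
  norm_num

theorem MeasureTheory.MemLp.integrable_real_inner {H : Type*} [NormedAddCommGroup H]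
    [InnerProductSpace ℝ H] {V W : Ω → H} (hV : MemLp V 2 P) (hW : MemLp W 2 P) :
    Integrable (fun ω => ⟪V ω, W ω⟫) P := by
  refine Integrable.mono' (hV.norm.integrable_mul hW.norm)
    (hV.aestronglyMeasurable.inner hW.aestronglyMeasurable) (ae_of_all _ fun ω => ?_)
  exact norm_inner_le_norm _ _

/-- A sequence in `L²` is norm-null as soon as the integrals of its squares tend to zero. -/
theorem tendsto_eLpNorm_two_zero_iff {ι H : Type*} [NormedAddCommGroup H] [InnerProductSpace ℝ H]
    {l : Filter ι} {V : ι → Ω → H} (hV : ∀ k, MemLp (V k) 2 P) :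
    Tendsto (fun k => eLpNorm (V k) 2 P) l (𝓝 0) ↔
      Tendsto (fun k => ∫ ω, ⟪V k ω, V k ω⟫ ∂P) l (𝓝 0) := by
  rw [← ENNReal.tendsto_toReal_iff (fun k => (hV k).eLpNorm_ne_top) ENNReal.zero_ne_top]
  simp_rw [← fun k => (hV k).toReal_eLpNorm_two_sq, ENNReal.toReal_zero]
  refine ⟨fun h => by simpa using h.pow 2, fun h => ?_⟩
  have := h.sqrt
  simpa [Real.sqrt_sq ENNReal.toReal_nonneg] using this

/-- Completeness of `L²`, for sequences of functions. -/
theorem exists_tendsto_eLpNorm_two {H : Type*} [NormedAddCommGroup H] [CompleteSpace H]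
    {u : ℕ → Ω → H} (hu : ∀ k, MemLp (u k) 2 P)
    (hc : Tendsto (fun q : ℕ × ℕ => eLpNorm (u q.1 - u q.2) 2 P) (atTop ×ˢ atTop) (𝓝 0)) :
    ∃ f, MemLp f 2 P ∧ Tendsto (fun k => eLpNorm (u k - f) 2 P) atTop (𝓝 0) := by
  have hcs : CauchySeq fun k => (hu k).toLp (u k) := by
    rw [cauchySeq_iff_tendsto_dist_atTop_0, ← prod_atTop_atTop_eq]
    have := (ENNReal.tendsto_toReal_iff
      (fun q : ℕ × ℕ => ((hu q.1).sub (hu q.2)).eLpNorm_ne_top) ENNReal.zero_ne_top).2 hc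
    refine this.congr fun q => ?_
    rw [dist_edist, Lp.edist_toLp_toLp]
  obtain ⟨F, hF⟩ := cauchySeq_tendsto_of_complete hcs
  refine ⟨F, Lp.memLp F, ?_⟩
  rw [tendsto_iff_edist_tendsto_0] at hF
  refine hF.congr fun k => ?_
  rw [Lp.edist_def]
  exact eLpNorm_congr_ae (((hu k).coeFn_toLp).sub (ae_eq_refl _))

/-- Convergent sequences of functions in `L²` are Cauchy. -/
theorem tendsto_eLpNorm_two_sub_sub {H : Type*} [NormedAddCommGroup H]
    {u : ℕ → Ω → H} {f : Ω → H} (hu : ∀ k, AEStronglyMeasurable (u k) P)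
    (hf : AEStronglyMeasurable f P)
    (h : Tendsto (fun k => eLpNorm (u k - f) 2 P) atTop (𝓝 0)) :
    Tendsto (fun q : ℕ × ℕ => eLpNorm (u q.1 - u q.2) 2 P) (atTop ×ˢ atTop) (𝓝 0) := by
  have h2 : Tendsto (fun q : ℕ × ℕ => eLpNorm (u q.1 - f) 2 P + eLpNorm (u q.2 - f) 2 P)
      (atTop ×ˢ atTop) (𝓝 0) := by
    simpa using (h.comp tendsto_fst).add (h.comp tendsto_snd)
  refine tendsto_of_tendsto_of_tendsto_of_le_of_le tendsto_const_nhds h2 (fun q => zero_le) ?_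
  intro q
  have : u q.1 - u q.2 = (u q.1 - f) - (u q.2 - f) := by abel
  simp only [this]
  exact eLpNorm_sub_le ((hu _).sub hf) ((hu _).sub hf) (by norm_num)

/-- `L²` convergence in both arguments gives `L¹` convergence of pointwise inner products. -/
theorem tendsto_eLpNorm_one_inner {H : Type*} [NormedAddCommGroup H] [InnerProductSpace ℝ H]
    {V W : ℕ → Ω → H} {V₀ W₀ : Ω → H} (hV : ∀ k, MemLp (V k) 2 P) (hW : ∀ k, MemLp (W k) 2 P)
    (hV₀ : MemLp V₀ 2 P) (hW₀ : MemLp W₀ 2 P)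
    (tV : Tendsto (fun k => eLpNorm (V k - V₀) 2 P) atTop (𝓝 0))
    (tW : Tendsto (fun k => eLpNorm (W k - W₀) 2 P) atTop (𝓝 0)) :
    Tendsto (fun k => eLpNorm ((fun ω => ⟪V k ω, W k ω⟫) - fun ω => ⟪V₀ ω, W₀ ω⟫) 1 P)
      atTop (𝓝 0) := by
  have hol : ∀ {A B : Ω → H}, MemLp A 2 P → MemLp B 2 P →
      eLpNorm (fun ω => ⟪A ω, B ω⟫) 1 P ≤ eLpNorm A 2 P * eLpNorm B 2 P := by
    intro A B hA hB
    have := eLpNorm_le_eLpNorm_mul_eLpNorm'_of_norm (p := 2) (q := 2) (r := 1)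
      hA.aestronglyMeasurable hB.aestronglyMeasurable (fun x y : H => (⟪x, y⟫ : ℝ)) 1
      (ae_of_all _ fun ω => by simpa using norm_inner_le_norm (𝕜 := ℝ) (A ω) (B ω))
    simpa using this
  have hb : ∀ k, eLpNorm ((fun ω => ⟪V k ω, W k ω⟫) - fun ω => ⟪V₀ ω, W₀ ω⟫) 1 P ≤
      (eLpNorm (V k - V₀) 2 P * (eLpNorm (W k - W₀) 2 P + eLpNorm W₀ 2 P) +
        eLpNorm V₀ 2 P * eLpNorm (W k - W₀) 2 P) := by
    intro k
    have e : ((fun ω => ⟪V k ω, W k ω⟫) - fun ω => ⟪V₀ ω, W₀ ω⟫ : Ω → ℝ) =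
        ((fun ω => ⟪(V k - V₀) ω, (W k) ω⟫) + fun ω => ⟪V₀ ω, (W k - W₀) ω⟫ : Ω → ℝ) := by
      ext ω
      simp only [Pi.sub_apply, Pi.add_apply, inner_sub_left, inner_sub_right]
      ring
    rw [e]
    refine (eLpNorm_add_le (((hV k).sub hV₀).integrable_real_inner (hW k)).aestronglyMeasurable
      (hV₀.integrable_real_inner ((hW k).sub hW₀)).aestronglyMeasurable le_rfl).trans ?_
    gcongr
    · refine (hol ((hV k).sub hV₀) (hW k)).trans ?_
      gcongr
      have : W k = (W k - W₀) + W₀ := by abel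
      conv_lhs => rw [this]
      exact eLpNorm_add_le ((hW k).sub hW₀).aestronglyMeasurable hW₀.aestronglyMeasurable
        (by norm_num)
    · exact hol hV₀ ((hW k).sub hW₀)
  have lim : Tendsto (fun k => eLpNorm (V k - V₀) 2 P * (eLpNorm (W k - W₀) 2 P + eLpNorm W₀ 2 P) +
        eLpNorm V₀ 2 P * eLpNorm (W k - W₀) 2 P) atTop (𝓝 0) := by
    have h1 := ENNReal.Tendsto.mul tV (Or.inr (by simpa using hW₀.eLpNorm_ne_top))
      (tW.add_const (eLpNorm W₀ 2 P)) (Or.inr ENNReal.zero_ne_top)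
    have h2 := ENNReal.Tendsto.const_mul (a := eLpNorm V₀ 2 P) tW (Or.inr hV₀.eLpNorm_ne_top)
    simpa using h1.add h2
  exact tendsto_of_tendsto_of_tendsto_of_le_of_le tendsto_const_nhds lim (fun _ => zero_le) hb

end LTwo

/-! ### Functions of class `C¹ ∩ Lip` -/

section C1Lip

variable {m : ℕ}

theorem isC1Lip_clm {E : Type*} [NormedAddCommGroup E] [NormedSpace ℝ E] (L : E →L[ℝ] ℝ) :
    IsC1Lip (fun x => L x) :=
  ⟨L.contDiff, ⟨_, L.lipschitz⟩⟩

theorem partialDeriv_clm (L : (Fin m → ℝ) →L[ℝ] ℝ) (i : Fin m) (x : Fin m → ℝ) :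
    partialDeriv (fun x => L x) i x = L (Pi.single i 1) := by
  simp [partialDeriv, L.hasFDerivAt.fderiv]

theorem IsC1Lip.continuous_partialDeriv {F : (Fin m → ℝ) → ℝ} (hF : IsC1Lip F) (i : Fin m) :
    Continuous (partialDeriv F i) :=
  (hF.1.continuous_fderiv (by norm_num)).clm_apply continuous_const

theorem IsC1Lip.differentiable {E : Type*} [NormedAddCommGroup E] [NormedSpace ℝ E] {F : E → ℝ}
    (hF : IsC1Lip F) : Differentiable ℝ F :=
  hF.1.differentiable (by norm_num)

theorem IsC1Lip.continuous {E : Type*} [NormedAddCommGroup E] [NormedSpace ℝ E] {F : E → ℝ}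
    (hF : IsC1Lip F) : Continuous F :=
  hF.1.continuous

theorem IsC1Lip.exists_bound_partialDeriv {F : (Fin m → ℝ) → ℝ} (hF : IsC1Lip F) :
    ∃ C : ℝ, 0 ≤ C ∧ ∀ i x, |partialDeriv F i x| ≤ C := by
  obtain ⟨K, hK⟩ := hF.2
  refine ⟨K, K.2, fun i x => ?_⟩
  have h := (fderiv ℝ F x).le_opNorm (Pi.single i 1)
  have h2 := norm_fderiv_le_of_lipschitz ℝ hK (x₀ := x)
  have h3 : ‖(Pi.single i 1 : Fin m → ℝ)‖ ≤ 1 := by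
    rw [pi_norm_le_iff_of_nonneg zero_le_one]
    intro j
    by_cases hj : j = i <;> simp [hj]
  rw [partialDeriv, ← Real.norm_eq_abs]
  nlinarith [norm_nonneg (fderiv ℝ F x)]

theorem IsC1Lip.memLp_comp {Ω : Type*} [MeasurableSpace Ω] {P : Measure Ω} [IsFiniteMeasure P]
    {E : Type*} [NormedAddCommGroup E] [NormedSpace ℝ E] {F : E → ℝ} (hF : IsC1Lip F)
    {p : ENNReal} {U : Ω → E} (hU : MemLp U p P) :
    MemLp (fun ω => F (U ω)) p P := by
  obtain ⟨K, hK⟩ := hF.2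
  have h1 : MemLp (fun ω => F (U ω) - F 0) p P := by
    refine MemLp.of_le_mul (g := U) (c := K) hU
      ((hF.continuous.comp_aestronglyMeasurable hU.aestronglyMeasurable).sub
        aestronglyMeasurable_const) (ae_of_all _ fun ω => ?_)
    simpa [dist_eq_norm] using hK.dist_le_mul (U ω) 0
  convert h1.add (memLp_const (F 0)) using 1
  ext ω
  simp

end C1Lip

/-! ### Error structures from closed gradients -/

/-- `Gr` is (the graph of) a densely defined closed gradient on `L²(P)` with values in the `L²`
space of `H`-valued functions, obeying the chain rule of class `C¹ ∩ Lip`. -/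
structure ClosedGradient {Ω H : Type*} [MeasurableSpace Ω] [NormedAddCommGroup H]
    [InnerProductSpace ℝ H] (P : Measure Ω) (Gr : (Ω → ℝ) → (Ω → H) → Prop) : Prop where
  memLp : ∀ {f V}, Gr f V → MemLp f 2 P
  memLp_grad : ∀ {f V}, Gr f V → MemLp V 2 P
  congr : ∀ {f g V}, Gr f V → f =ᵐ[P] g → Gr g V
  unique : ∀ {f V W}, Gr f V → Gr f W → V =ᵐ[P] W
  closed : ∀ {f V} {u : ℕ → Ω → ℝ} {v : ℕ → Ω → H}, (∀ k, Gr (u k) (v k)) → MemLp f 2 P →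
    MemLp V 2 P → Tendsto (fun k => eLpNorm (u k - f) 2 P) atTop (𝓝 0) →
    Tendsto (fun k => eLpNorm (v k - V) 2 P) atTop (𝓝 0) → Gr f V
  chain : ∀ {m : ℕ} {U : Fin m → Ω → ℝ} {V : Fin m → Ω → H} {F : (Fin m → ℝ) → ℝ},
    (∀ i, Gr (U i) (V i)) → IsC1Lip F →
    Gr (fun ω => F fun i => U i ω) (fun ω => ∑ i, partialDeriv F i (fun i => U i ω) • V i ω)
  dense : ∀ f : Ω → ℝ, MemLp f 2 P → ∀ ε : ENNReal, 0 < ε →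
    ∃ g V, Gr g V ∧ eLpNorm (f - g) 2 P < ε

namespace ClosedGradient

variable {Ω H : Type*} [MeasurableSpace Ω] [NormedAddCommGroup H] [InnerProductSpace ℝ H]
  {P : Measure Ω} {Gr : (Ω → ℝ) → (Ω → H) → Prop}

theorem add (hG : ClosedGradient P Gr) {f g : Ω → ℝ} {V W : Ω → H} (hf : Gr f V) (hg : Gr g W) :
    Gr (f + g) (V + W) := by
  have h := hG.chain (U := ![f, g]) (V := ![V, W])
    (F := fun x => (ContinuousLinearMap.proj (R := ℝ) (φ := fun _ : Fin 2 => ℝ) 0 +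
      ContinuousLinearMap.proj (R := ℝ) (φ := fun _ : Fin 2 => ℝ) 1) x)
    (by intro i; fin_cases i <;> simpa) (isC1Lip_clm _)
  simp only [partialDeriv_clm] at h
  convert h using 1
  · ext ω
    simp
  · funext ω
    simp [Fin.sum_univ_two]

theorem smul (hG : ClosedGradient P Gr) (a : ℝ) {f : Ω → ℝ} {V : Ω → H} (hf : Gr f V) :
    Gr (a • f) (a • V) := by
  have h := hG.chain (U := ![f]) (V := ![V])
    (F := fun x => (a • ContinuousLinearMap.proj (R := ℝ) (φ := fun _ : Fin 1 => ℝ) 0) x)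
    (by intro i; fin_cases i; simpa) (isC1Lip_clm _)
  simp only [partialDeriv_clm] at h
  convert h using 1
  · ext ω
    simp
  · funext ω
    simp

theorem sub (hG : ClosedGradient P Gr) {f g : Ω → ℝ} {V W : Ω → H} (hf : Gr f V) (hg : Gr g W) :
    Gr (f - g) (V - W) := by
  have h := hG.add hf (hG.smul (-1) hg)
  simpa [sub_eq_add_neg] using h

/-- The squared field operator `Γ[f, h] = ⟪∇f, ∇h⟫` of a closed gradient is that of an error
structure: the functional calculus is the chain rule and completeness is closedness. -/
theorem isErrorStructure [CompleteSpace H] {S : ErrorData Ω} (hG : ClosedGradient S.P Gr)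
    (hdom : ∀ f, f ∈ S.Dom ↔ ∃ V, Gr f V)
    (hΓ : ∀ {f h V W}, Gr f V → Gr h W → S.Γ f h =ᵐ[S.P] fun ω => ⟪V ω, W ω⟫) :
    S.IsErrorStructure where
  memLp f hf := by
    obtain ⟨V, hV⟩ := (hdom f).1 hf
    exact hG.memLp hV
  dom_congr f hf g hfg := by
    obtain ⟨V, hV⟩ := (hdom f).1 hf
    exact (hdom g).2 ⟨V, hG.congr hV hfg⟩
  dom_add f hf g hg := by
    obtain ⟨V, hV⟩ := (hdom f).1 hf
    obtain ⟨W, hW⟩ := (hdom g).1 hg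
    exact (hdom _).2 ⟨_, hG.add hV hW⟩
  dom_smul a f hf := by
    obtain ⟨V, hV⟩ := (hdom f).1 hf
    exact (hdom _).2 ⟨_, hG.smul a hV⟩
  dense f hf ε hε := by
    obtain ⟨g, V, hg, h⟩ := hG.dense f hf ε hε
    exact ⟨g, (hdom g).2 ⟨V, hg⟩, h⟩
  gamma_integrable f hf g hg := by
    obtain ⟨V, hV⟩ := (hdom f).1 hf
    obtain ⟨W, hW⟩ := (hdom g).1 hg
    exact ((hG.memLp_grad hV).integrable_real_inner (hG.memLp_grad hW)).congr (hΓ hV hW).symm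
  gamma_congr f hf f' hf' g hg hff' := by
    obtain ⟨V, hV⟩ := (hdom f).1 hf
    obtain ⟨W, hW⟩ := (hdom g).1 hg
    exact (hΓ hV hW).trans (hΓ (hG.congr hV hff') hW).symm
  gamma_symm f hf g hg := by
    obtain ⟨V, hV⟩ := (hdom f).1 hf
    obtain ⟨W, hW⟩ := (hdom g).1 hg
    filter_upwards [hΓ hV hW, hΓ hW hV] with ω h1 h2
    rw [h1, h2, real_inner_comm]
  gamma_add f hf g hg h hh := by
    obtain ⟨V, hV⟩ := (hdom f).1 hf
    obtain ⟨W, hW⟩ := (hdom g).1 hg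
    obtain ⟨X, hX⟩ := (hdom h).1 hh
    filter_upwards [hΓ hV hX, hΓ hW hX, hΓ (hG.add hV hW) hX] with ω h1 h2 h3
    rw [Pi.add_apply, h1, h2, h3, Pi.add_apply, inner_add_left]
  gamma_smul a f hf g hg := by
    obtain ⟨V, hV⟩ := (hdom f).1 hf
    obtain ⟨W, hW⟩ := (hdom g).1 hg
    filter_upwards [hΓ hV hW, hΓ (hG.smul a hV) hW] with ω h1 h2
    rw [Pi.smul_apply, h1, h2, Pi.smul_apply, real_inner_smul_left, smul_eq_mul]
  gamma_nonneg f hf := by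
    obtain ⟨V, hV⟩ := (hdom f).1 hf
    filter_upwards [hΓ hV hV] with ω h1
    rw [h1]
    exact real_inner_self_nonneg
  calculus_mem m U F hU hF := by
    choose V hV using fun i => (hdom (U i)).1 (hU i)
    exact (hdom _).2 ⟨_, hG.chain hV hF⟩
  calculus_gamma m n U V F G hU hV hF hG' := by
    choose X hX using fun i => (hdom (U i)).1 (hU i)
    choose Y hY using fun i => (hdom (V i)).1 (hV i)
    have h := ae_all_iff.2 fun i => ae_all_iff.2 fun j => hΓ (hX i) (hY j)
    filter_upwards [h, hΓ (hG.chain hX hF) (hG.chain hY hG')] with ω h1 h2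
    rw [h2, sum_inner]
    refine Finset.sum_congr rfl fun i _ => ?_
    rw [inner_sum]
    refine Finset.sum_congr rfl fun j _ => ?_
    rw [h1, real_inner_smul_left, real_inner_smul_right]
    ring
  one_mem := by
    refine (hdom _).2 ⟨_, hG.chain (m := 0) (U := fun i => i.elim0) (V := fun i => i.elim0)
      (F := fun _ => 1) (fun i => i.elim0) ⟨contDiff_const, 0, LipschitzWith.const _⟩⟩
  complete u hu hu2 hE := by
    choose v hv using fun k => (hdom (u k)).1 (hu k)
    have energy_eq : ∀ {f V}, Gr f V → S.energy f = (1 / 2) * ∫ ω, ⟪V ω, V ω⟫ ∂S.P :=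
      fun h => by rw [ErrorData.energy, integral_congr_ae (hΓ h h)]
    have hE' : Tendsto (fun q : ℕ × ℕ => eLpNorm (v q.1 - v q.2) 2 S.P) (atTop ×ˢ atTop)
        (𝓝 0) := by
      rw [tendsto_eLpNorm_two_zero_iff
        fun q : ℕ × ℕ => hG.memLp_grad (hG.sub (hv q.1) (hv q.2))]
      have := hE.const_mul 2
      simp_rw [fun q : ℕ × ℕ => energy_eq (hG.sub (hv q.1) (hv q.2))] at this
      simpa using this
    obtain ⟨f, hf, hf'⟩ := exists_tendsto_eLpNorm_two (fun k => hG.memLp (hv k)) hu2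
    obtain ⟨V, hV, hV'⟩ := exists_tendsto_eLpNorm_two (fun k => hG.memLp_grad (hv k)) hE'
    have hfV := hG.closed hv hf hV hf' hV'
    refine ⟨f, (hdom f).2 ⟨V, hfV⟩, hf', ?_⟩
    simp_rw [fun k => energy_eq (hG.sub (hv k) hfV)]
    rw [tendsto_eLpNorm_two_zero_iff fun k => hG.memLp_grad (hG.sub (hv k) hfV)] at hV'
    simpa only [mul_zero] using hV'.const_mul (1 / 2)

end ClosedGradient

/-! ### Products with bounded factors in `L²` -/

section LTwo

variable {Ω : Type*} [MeasurableSpace Ω] {P : Measure Ω}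

theorem tendsto_eLpNorm_sum_zero {ι E : Type*} [Fintype ι] [NormedAddCommGroup E]
    {u : ι → ℕ → Ω → E} (hu : ∀ i k, AEStronglyMeasurable (u i k) P)
    (h : ∀ i, Tendsto (fun k => eLpNorm (u i k) 2 P) atTop (𝓝 0)) :
    Tendsto (fun k => eLpNorm (fun ω => ∑ i, u i k ω) 2 P) atTop (𝓝 0) := by
  have h2 : Tendsto (fun k => ∑ i, eLpNorm (u i k) 2 P) atTop (𝓝 0) := by
    simpa using tendsto_finsetSum Finset.univ fun i _ => h i
  refine tendsto_of_tendsto_of_tendsto_of_le_of_le tendsto_const_nhds h2 (fun _ => zero_le) ?_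
  intro k
  have : (fun ω => ∑ i, u i k ω) = ∑ i, u i k := by ext1 ω; simp
  simp only [this]
  exact eLpNorm_sum_le (fun i _ => hu i k) (by norm_num)

theorem tendsto_eLpNorm_pi_zero {ι : Type*} [Fintype ι] {u : ι → ℕ → Ω → ℝ}
    (hu : ∀ i k, AEStronglyMeasurable (u i k) P)
    (h : ∀ i, Tendsto (fun k => eLpNorm (u i k) 2 P) atTop (𝓝 0)) :
    Tendsto (fun k => eLpNorm (fun ω i => u i k ω) 2 P) atTop (𝓝 0) := by
  have h2 := tendsto_eLpNorm_sum_zero (u := fun i k ω => ‖u i k ω‖) (fun i k => (hu i k).norm)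
    (fun i => by simpa only [eLpNorm_norm] using h i)
  refine tendsto_of_tendsto_of_tendsto_of_le_of_le tendsto_const_nhds h2 (fun _ => zero_le) ?_
  intro k
  refine eLpNorm_mono fun ω => ?_
  have h0 : 0 ≤ ∑ i, ‖u i k ω‖ := Finset.sum_nonneg fun _ _ => norm_nonneg _
  rw [Real.norm_of_nonneg h0, pi_norm_le_iff_of_nonneg h0]
  exact fun i => Finset.single_le_sum (f := fun i => ‖u i k ω‖) (fun _ _ => norm_nonneg _)
    (Finset.mem_univ i)

theorem tendsto_eLpNorm_two_smul_of_tendsto_zero {H : Type*} [NormedAddCommGroup H]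
    [InnerProductSpace ℝ H] {g : ℕ → Ω → ℝ} {V : Ω → H} {C : ℝ}
    (hg : ∀ k, AEStronglyMeasurable (g k) P) (hC : ∀ k ω, |g k ω| ≤ C)
    (hlim : ∀ᵐ ω ∂P, Tendsto (fun k => g k ω) atTop (𝓝 0)) (hV : MemLp V 2 P) :
    Tendsto (fun k => eLpNorm (fun ω => g k ω • V ω) 2 P) atTop (𝓝 0) := by
  have hm : ∀ k, MemLp (fun ω => g k ω • V ω) 2 P := fun k =>
    MemLp.of_le_mul (c := C) hV ((hg k).smul hV.aestronglyMeasurable)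
      (ae_of_all _ fun ω => by
        rw [norm_smul]
        exact mul_le_mul_of_nonneg_right (hC k ω) (norm_nonneg _))
  rw [tendsto_eLpNorm_two_zero_iff hm, ← integral_zero Ω ℝ (μ := P)]
  have e : ∀ k ω, ⟪g k ω • V ω, g k ω • V ω⟫ = g k ω ^ 2 * ⟪V ω, V ω⟫ := fun k ω => by
    rw [real_inner_smul_left, real_inner_smul_right, ← mul_assoc, ← sq]
  refine tendsto_integral_of_dominated_convergence (fun ω => C ^ 2 * ⟪V ω, V ω⟫)
    (fun k => ((hm k).integrable_real_inner (hm k)).aestronglyMeasurable)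
    ((hV.integrable_real_inner hV).const_mul _) (fun k => ae_of_all _ fun ω => ?_) ?_
  · rw [e, Real.norm_of_nonneg (mul_nonneg (sq_nonneg _) real_inner_self_nonneg)]
    exact mul_le_mul_of_nonneg_right (sq_le_sq' (abs_le.1 (hC k ω)).1 (abs_le.1 (hC k ω)).2)
      real_inner_self_nonneg
  · filter_upwards [hlim] with ω hω
    simp_rw [e]
    have := (hω.pow 2).mul_const ⟪V ω, V ω⟫
    rwa [zero_pow two_ne_zero, zero_mul] at this

/-- Multiplying an `L²`-convergent sequence by uniformly bounded, almost everywhere convergent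
factors preserves `L²` convergence. -/
theorem tendsto_eLpNorm_two_smul {H : Type*} [NormedAddCommGroup H]
    [InnerProductSpace ℝ H] {g : ℕ → Ω → ℝ} {g₀ : Ω → ℝ} {V : ℕ → Ω → H} {V₀ : Ω → H} {C : ℝ}
    (hg : ∀ k, AEStronglyMeasurable (g k) P) (hg₀ : AEStronglyMeasurable g₀ P)
    (hC : ∀ k ω, |g k ω| ≤ C) (hC₀ : ∀ ω, |g₀ ω| ≤ C)
    (hlim : ∀ᵐ ω ∂P, Tendsto (fun k => g k ω) atTop (𝓝 (g₀ ω)))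
    (hV : ∀ k, MemLp (V k) 2 P) (hV₀ : MemLp V₀ 2 P)
    (h : Tendsto (fun k => eLpNorm (V k - V₀) 2 P) atTop (𝓝 0)) :
    Tendsto (fun k => eLpNorm (fun ω => g k ω • V k ω - g₀ ω • V₀ ω) 2 P) atTop (𝓝 0) := by
  have h1 := tendsto_eLpNorm_two_smul_of_tendsto_zero (g := fun k ω => g k ω - g₀ ω) (C := C + C)
    (fun k => (hg k).sub hg₀)
    (fun k ω => (abs_sub _ _).trans (add_le_add (hC k ω) (hC₀ ω)))
    (by filter_upwards [hlim] with ω hω using by simpa using hω.sub_const (g₀ ω)) hV₀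
  have hm1 : ∀ k, AEStronglyMeasurable (fun ω => (g k ω - g₀ ω) • V₀ ω) P := fun k =>
    ((hg k).sub hg₀).smul hV₀.aestronglyMeasurable
  have hm2 : ∀ k, AEStronglyMeasurable (fun ω => g k ω • (V k - V₀) ω) P := fun k =>
    (hg k).smul ((hV k).sub hV₀).aestronglyMeasurable
  have h2 : Tendsto (fun k => eLpNorm (fun ω => g k ω • (V k - V₀) ω) 2 P) atTop (𝓝 0) := by
    have hb : Tendsto (fun k => ENNReal.ofReal C * eLpNorm (V k - V₀) 2 P) atTop (𝓝 0) := by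
      simpa using ENNReal.Tendsto.const_mul (a := ENNReal.ofReal C) h (Or.inr ENNReal.ofReal_ne_top)
    refine tendsto_of_tendsto_of_tendsto_of_le_of_le tendsto_const_nhds hb (fun _ => zero_le) ?_
    intro k
    refine eLpNorm_le_mul_eLpNorm_of_ae_le_mul (ae_of_all _ fun ω => ?_) 2
    rw [norm_smul]
    exact mul_le_mul_of_nonneg_right (hC k ω) (norm_nonneg _)
  have h3 := h1.add h2
  rw [add_zero] at h3
  refine tendsto_of_tendsto_of_tendsto_of_le_of_le tendsto_const_nhds h3 (fun _ => zero_le) ?_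
  intro k
  have e : (fun ω => g k ω • V k ω - g₀ ω • V₀ ω) =
      (fun ω => (g k ω - g₀ ω) • V₀ ω) + fun ω => g k ω • (V k - V₀) ω := by
    funext ω
    simp only [Pi.add_apply, Pi.sub_apply, smul_sub, sub_smul]
    abel
  simp only [e]
  exact eLpNorm_add_le (hm1 k) (hm2 k) (by norm_num)

end LTwo

theorem fderiv_apply_eq_sum_partialDeriv {m : ℕ} (F : (Fin m → ℝ) → ℝ) (x v : Fin m → ℝ) :
    fderiv ℝ F x v = ∑ i, v i * partialDeriv F i x := by
  conv_lhs => rw [← Finset.univ_sum_single v]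
  rw [map_sum]
  refine Finset.sum_congr rfl fun i _ => ?_
  rw [partialDeriv, ← smul_eq_mul, ← map_smul, ← Pi.single_smul, smul_eq_mul, mul_one]

namespace WienerSpace

/-! ### The closed gradient on Wiener space -/

/-- The Hilbert space in which gradients on the Wiener space take their values.  Elements of
`L²([0, 1])` are regarded as functions on the line which vanish outside of `[0, 1]`. -/
abbrev GradSpace : Type := Lp ℝ 2 (volume : Measure ℝ)

/-- The indicator function of `(0, s]` in `L²(ℝ)`: the gradient of `B s`, up to the factor `√c`. -/
def timeVec (s : unitInterval) : GradSpace :=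
  indicatorConstLp 2 (measurableSet_Ioc : MeasurableSet (Set.Ioc (0 : ℝ) s)) (by simp) 1

theorem inner_timeVec (s t : unitInterval) : ⟪timeVec s, timeVec t⟫ = min (s : ℝ) (t : ℝ) := by
  have h : (0 : ℝ) ≤ min (s : ℝ) (t : ℝ) := le_min s.2.1 t.2.1
  rw [timeVec, timeVec,
    L2.real_inner_indicatorConstLp_one_indicatorConstLp_one _ _ (by simp) (by simp),
    Set.Ioc_inter_Ioc]
  simp only [max_self, Real.volume_real_Ioc, sub_zero]
  exact max_eq_left h

/-- The gradient `√c ∑ᵢ φ'ᵢ(B_{t₁}, …, B_{t_q}) 1_{(0, tᵢ]}` of a cylinder function. -/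
def Cylinder.grad (c : ℝ) (a : Cylinder) (w : Path) : GradSpace :=
  √c • ∑ i, partialDeriv a.φ i (a.coords w) • timeVec (a.t i)

theorem cylGamma_eq_inner {c : ℝ} (hc : 0 ≤ c) (a b : Cylinder) (w : Path) :
    cylGamma c a b w = ⟪a.grad c w, b.grad c w⟫ := by
  rw [Cylinder.grad, Cylinder.grad, real_inner_smul_left, real_inner_smul_right, ← mul_assoc,
    Real.mul_self_sqrt hc, sum_inner, Finset.mul_sum, cylGamma]
  refine Finset.sum_congr rfl fun i _ => ?_
  rw [inner_sum, Finset.mul_sum]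
  refine Finset.sum_congr rfl fun j _ => ?_
  rw [real_inner_smul_left, real_inner_smul_right, inner_timeVec]
  ring

/-- Finitely many cylinder functions can be written over one common family of times. -/
theorem exists_common_times {m : ℕ} (a : Fin m → Cylinder) :
    ∃ (N : ℕ) (s : Fin N → unitInterval) (idx : ∀ i, Fin (a i).q → Fin N),
      ∀ i j, s (idx i j) = (a i).t j :=
  ⟨∑ i, (a i).q, fun n => (a (finSigmaFinEquiv.symm n).1).t (finSigmaFinEquiv.symm n).2,
    fun i j => finSigmaFinEquiv ⟨i, j⟩, fun i j =>
      congrArg (fun p : (i : Fin m) × Fin (a i).q => (a p.1).t p.2)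
        (Equiv.symm_apply_apply finSigmaFinEquiv ⟨i, j⟩)⟩

/-- The chain rule for cylinder functions. -/
theorem Cylinder.exists_comp {m : ℕ} (a : Fin m → Cylinder) {F : (Fin m → ℝ) → ℝ}
    (hF : IsC1Lip F) : ∃ b : Cylinder, (∀ w, b.eval w = F fun i => (a i).eval w) ∧
      ∀ c w, b.grad c w =
        ∑ i, partialDeriv F i (fun i => (a i).eval w) • (a i).grad c w := by
  obtain ⟨N, s, idx, hs⟩ := exists_common_times a
  let π : ∀ i, (Fin N → ℝ) →L[ℝ] (Fin (a i).q → ℝ) := fun i =>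
    ContinuousLinearMap.pi fun j => ContinuousLinearMap.proj (idx i j)
  let Φ : (Fin N → ℝ) → Fin m → ℝ := fun x i => (a i).φ (π i x)
  have hΦ : ContDiff ℝ 1 Φ :=
    contDiff_pi' fun i => (a i).isC1Lip.1.comp (π i).contDiff
  have hC1Lip : IsC1Lip (F ∘ Φ) := by
    refine ⟨hF.1.comp hΦ, ?_⟩
    obtain ⟨K, hK⟩ := hF.2
    choose L hL using fun i => (a i).isC1Lip.2
    have hL' : ∀ i, LipschitzWith (L i * ‖π i‖₊) fun x => (a i).φ (π i x) := fun i =>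
      (hL i).comp (π i).lipschitz
    refine ⟨K * ∑ i, (L i * ‖π i‖₊), hK.comp (LipschitzWith.of_dist_le_mul fun x y => ?_)⟩
    rw [dist_pi_le_iff (by positivity)]
    intro i
    refine ((hL' i).dist_le_mul x y).trans ?_
    gcongr
    exact Finset.single_le_sum (f := fun i => L i * ‖π i‖₊) (fun _ _ => zero_le)
      (Finset.mem_univ i)
  have hπ : ∀ (w : Path) i, π i (fun n => w (s n)) = (a i).coords w := fun w i => by
    ext j
    simp [π, Cylinder.coords, hs]
  refine ⟨⟨N, s, F ∘ Φ, hC1Lip⟩, fun w => ?_, fun c w => ?_⟩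
  · change F (Φ _) = _
    congr 1
    ext i
    exact congrArg (a i).φ (hπ w i)
  · have hd : ∀ v : Fin N → ℝ, fderiv ℝ (F ∘ Φ) (fun n => w (s n)) v =
        ∑ i, partialDeriv F i (fun i => (a i).eval w) *
          ∑ j, v (idx i j) * partialDeriv (a i).φ j ((a i).coords w) := by
      intro v
      have h1 : ∀ i, HasFDerivAt (fun x => (a i).φ (π i x))
          ((fderiv ℝ (a i).φ ((a i).coords w)).comp (π i)) (fun n => w (s n)) := fun i => by
        have := ((a i).isC1Lip.differentiable ((a i).coords w)).hasFDerivAt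
        rw [← hπ w i] at this ⊢
        exact this.comp _ (π i).hasFDerivAt
      have h2 := (hF.differentiable (Φ fun n => w (s n))).hasFDerivAt.comp (fun n => w (s n))
        (hasFDerivAt_pi.2 h1)
      have h3 : (Φ fun n => w (s n)) = fun i => (a i).eval w :=
        funext fun i => congrArg (a i).φ (hπ w i)
      rw [h2.fderiv, ContinuousLinearMap.comp_apply, fderiv_apply_eq_sum_partialDeriv, h3]
      refine Finset.sum_congr rfl fun i _ => ?_
      rw [mul_comm]
      congr 1
      simp only [ContinuousLinearMap.coe_pi', ContinuousLinearMap.comp_apply]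
      rw [fderiv_apply_eq_sum_partialDeriv]
      rfl
    have hn : ∀ n, partialDeriv (F ∘ Φ) n (fun n => w (s n)) =
        ∑ i, ∑ j, partialDeriv F i (fun i => (a i).eval w) *
          (Pi.single (M := fun _ => ℝ) n 1 (idx i j) *
            partialDeriv (a i).φ j ((a i).coords w)) := fun n => by
      rw [partialDeriv, hd]
      simp_rw [Finset.mul_sum]
    simp only [Cylinder.grad, smul_comm _ √c]
    rw [← Finset.smul_sum]
    congr 1
    change ∑ n, partialDeriv (F ∘ Φ) n (fun n => w (s n)) • timeVec (s n) = _
    simp_rw [hn, Finset.sum_smul, Finset.smul_sum]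
    rw [Finset.sum_comm]
    refine Finset.sum_congr rfl fun i _ => ?_
    rw [Finset.sum_comm]
    refine Finset.sum_congr rfl fun j _ => ?_
    rw [Finset.sum_eq_single (idx i j)]
    · simp [hs, smul_smul]
    · intro n _ hne
      simp [Pi.single_eq_of_ne hne.symm]
    · simp

theorem Cylinder.continuous_coords (a : Cylinder) : Continuous a.coords :=
  continuous_pi fun _ => ContinuousEvalConst.continuous_eval_const _

theorem Cylinder.continuous_eval (a : Cylinder) : Continuous a.eval :=
  a.isC1Lip.continuous.comp a.continuous_coords

theorem Cylinder.continuous_grad (c : ℝ) (a : Cylinder) : Continuous (a.grad c) := by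
  have h : ∀ i, Continuous fun w => partialDeriv a.φ i (a.coords w) • timeVec (a.t i) := fun i =>
    ((a.isC1Lip.continuous_partialDeriv i).comp a.continuous_coords).smul continuous_const
  exact (continuous_finsetSum _ fun i _ => h i).const_smul √c

theorem Cylinder.memLp_grad (c : ℝ) (a : Cylinder) {m : Measure Path} [IsFiniteMeasure m]
    (p : ENNReal) : MemLp (a.grad c) p m := by
  obtain ⟨C, hC, hb⟩ := a.isC1Lip.exists_bound_partialDeriv
  refine MemLp.of_bound (a.continuous_grad c).aestronglyMeasurable
    (√c * ∑ i, C * ‖timeVec (a.t i)‖) (ae_of_all _ fun w => ?_)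
  rw [Cylinder.grad, norm_smul, Real.norm_of_nonneg (Real.sqrt_nonneg c)]
  gcongr
  refine (norm_sum_le _ _).trans (Finset.sum_le_sum fun i _ => ?_)
  rw [norm_smul]
  gcongr
  exact hb i _

theorem IsWienerMeasure.memLp_coord {v : ℝ} {m : Measure Path} (hW : IsWienerMeasure v m)
    (t : unitInterval) {p : ENNReal} (hp : p ≠ ⊤) : MemLp (fun w : Path => w t) p m :=
  (hW.isGaussian.hasGaussianLaw_eval t).memLp hp

theorem IsWienerMeasure.memLp_eval {v : ℝ} {m : Measure Path} [IsFiniteMeasure m]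
    (hW : IsWienerMeasure v m) (a : Cylinder) {p : ENNReal} (hp : p ≠ ⊤) :
    MemLp a.eval p m :=
  a.isC1Lip.memLp_comp (MemLp.of_eval fun i => hW.memLp_coord (a.t i) hp)

/-- `f` is the limit in `L²(m)` of cylinder functions whose gradients converge to `V` in
`L²(m)`, that is, `V` is the gradient of `f` for the closure of the gradient on cylinder
functions. -/
def IsGrad (c : ℝ) (m : Measure Path) (f : Path → ℝ) (V : Path → GradSpace) : Prop :=
  MemLp f 2 m ∧ MemLp V 2 m ∧ ∃ a : ℕ → Cylinder,
    Tendsto (fun k => eLpNorm ((a k).eval - f) 2 m) atTop (𝓝 0) ∧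
      Tendsto (fun k => eLpNorm ((a k).grad c - V) 2 m) atTop (𝓝 0)

variable {c v : ℝ} {m : Measure Path}

theorem IsGrad.congr {f g : Path → ℝ} {V : Path → GradSpace} (h : IsGrad c m f V)
    (hfg : f =ᵐ[m] g) : IsGrad c m g V := by
  obtain ⟨h1, h2, a, h3, h4⟩ := h
  refine ⟨h1.ae_eq hfg, h2, a, h3.congr fun k => ?_, h4⟩
  exact eLpNorm_congr_ae ((ae_eq_refl _).sub hfg)

theorem isGrad_cylinder [IsFiniteMeasure m] (hW : IsWienerMeasure v m) (a : Cylinder) :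
    IsGrad c m a.eval (a.grad c) :=
  ⟨hW.memLp_eval a (by simp), a.memLp_grad c 2, fun _ => a, by simp, by simp⟩

theorem IsGrad.closed [IsFiniteMeasure m] (hW : IsWienerMeasure v m) {f : Path → ℝ}
    {V : Path → GradSpace} {u : ℕ → Path → ℝ}
    {U : ℕ → Path → GradSpace} (h : ∀ k, IsGrad c m (u k) (U k)) (hf : MemLp f 2 m)
    (hV : MemLp V 2 m) (h1 : Tendsto (fun k => eLpNorm (u k - f) 2 m) atTop (𝓝 0))
    (h2 : Tendsto (fun k => eLpNorm (U k - V) 2 m) atTop (𝓝 0)) : IsGrad c m f V := by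
  have key : ∀ k : ℕ, ∃ a : Cylinder, eLpNorm (a.eval - u k) 2 m < ((k : ENNReal) + 1)⁻¹ ∧
      eLpNorm (a.grad c - U k) 2 m < ((k : ENNReal) + 1)⁻¹ := by
    intro k
    obtain ⟨-, -, a, h3, h4⟩ := h k
    have hpos : (0 : ENNReal) < ((k : ENNReal) + 1)⁻¹ := by simp
    obtain ⟨n, hn⟩ := ((h3.eventually (gt_mem_nhds hpos)).and
      (h4.eventually (gt_mem_nhds hpos))).exists
    exact ⟨a n, hn⟩
  choose a ha1 ha2 using key
  have hlim : Tendsto (fun k : ℕ => ((k : ENNReal) + 1)⁻¹) atTop (𝓝 0) := by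
    have := ENNReal.tendsto_inv_nat_nhds_zero.comp (tendsto_add_atTop_nat 1)
    refine this.congr fun k => ?_
    simp
  refine ⟨hf, hV, a, ?_, ?_⟩
  · have hs := hlim.add h1
    rw [add_zero] at hs
    refine tendsto_of_tendsto_of_tendsto_of_le_of_le tendsto_const_nhds hs (fun _ => zero_le)
      fun k => ?_
    have e : (a k).eval - f = ((a k).eval - u k) + (u k - f) := by abel
    simp only [e]
    refine (eLpNorm_add_le ((hW.memLp_eval (a k) (by simp)).sub (h k).1).aestronglyMeasurable
      ((h k).1.sub hf).aestronglyMeasurable (by norm_num)).trans ?_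
    exact add_le_add_left (ha1 k).le _
  · have hs := hlim.add h2
    rw [add_zero] at hs
    refine tendsto_of_tendsto_of_tendsto_of_le_of_le tendsto_const_nhds hs (fun _ => zero_le)
      fun k => ?_
    have e : (a k).grad c - V = ((a k).grad c - U k) + (U k - V) := by abel
    simp only [e]
    refine (eLpNorm_add_le (((a k).memLp_grad c 2).sub (h k).2.1).aestronglyMeasurable
      ((h k).2.1.sub hV).aestronglyMeasurable (by norm_num)).trans ?_
    exact add_le_add_left (ha2 k).le _

/-- The chain rule for the closed gradient.  Almost everywhere convergence along a subsequence
lets one pass to the limit in the bounded factors `F'ᵢ`. -/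
theorem IsGrad.chain [IsFiniteMeasure m] (hW : IsWienerMeasure v m) {p : ℕ}
    {U : Fin p → Path → ℝ} {V : Fin p → Path → GradSpace} {F : (Fin p → ℝ) → ℝ}
    (h : ∀ i, IsGrad c m (U i) (V i)) (hF : IsC1Lip F) :
    IsGrad c m (fun w => F fun i => U i w)
      (fun w => ∑ i, partialDeriv F i (fun i => U i w) • V i w) := by
  obtain ⟨C, hC0, hC⟩ := hF.exists_bound_partialDeriv
  have hU : ∀ i, MemLp (U i) 2 m := fun i => (h i).1
  have hV : ∀ i, MemLp (V i) 2 m := fun i => (h i).2.1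
  have hUm : AEStronglyMeasurable (fun w i => U i w) m :=
    (MemLp.of_eval fun i => hU i).aestronglyMeasurable
  choose a ha hga using fun i => (h i).2.2
  have hae : ∀ i k, MemLp (a i k).eval 2 m := fun i k => hW.memLp_eval _ (by simp)
  have hvec := tendsto_eLpNorm_pi_zero (u := fun i k => (a i k).eval - U i)
    (fun i k => ((hae i k).sub (hU i)).aestronglyMeasurable) ha
  obtain ⟨ns, hns, hlim⟩ := (tendstoInMeasure_of_tendsto_eLpNorm two_ne_zero
    (f := fun k w i => (a i k).eval w) (g := fun w i => U i w)
    (fun k => (MemLp.of_eval fun i => hae i k).aestronglyMeasurable) hUm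
    hvec).exists_seq_tendsto_ae
  choose b hb hgb using fun k => Cylinder.exists_comp (fun i => a i (ns k)) hF
  have hterm : ∀ i, MemLp (fun w => partialDeriv F i (fun i => U i w) • V i w) 2 m := fun i =>
    MemLp.of_le_mul (c := C) (hV i)
      (((hF.continuous_partialDeriv i).comp_aestronglyMeasurable hUm).smul
        (hV i).aestronglyMeasurable) (ae_of_all _ fun w => by
        rw [norm_smul]
        exact mul_le_mul_of_nonneg_right (hC i _) (norm_nonneg _))
  refine ⟨hF.memLp_comp (MemLp.of_eval hU), memLp_finsetSum _ fun i _ => hterm i, b, ?_, ?_⟩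
  · obtain ⟨K, hK⟩ := hF.2
    have hs : Tendsto (fun k => (K : ENNReal) *
        eLpNorm (fun w i => ((a i (ns k)).eval - U i) w) 2 m) atTop (𝓝 0) := by
      simpa using ENNReal.Tendsto.const_mul (a := (K : ENNReal)) (hvec.comp hns.tendsto_atTop)
        (Or.inr ENNReal.coe_ne_top)
    refine tendsto_of_tendsto_of_tendsto_of_le_of_le tendsto_const_nhds hs (fun _ => zero_le)
      fun k => ?_
    refine (eLpNorm_le_nnreal_smul_eLpNorm_of_ae_le_mul (c := K) (ae_of_all _ fun w => ?_) 2)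
    rw [Pi.sub_apply, hb]
    have := hK.dist_le_mul (fun i => (a i (ns k)).eval w) (fun i => U i w)
    rw [dist_eq_norm, dist_eq_norm] at this
    exact_mod_cast this
  · have hs := tendsto_eLpNorm_sum_zero (P := m)
      (u := fun i k w => partialDeriv F i (fun i => (a i (ns k)).eval w) • (a i (ns k)).grad c w
        - partialDeriv F i (fun i => U i w) • V i w) (fun i k => ?_) fun i => ?_
    · refine hs.congr fun k => ?_
      congr 1
      funext w
      rw [Pi.sub_apply, hgb, Finset.sum_sub_distrib]
    · refine AEStronglyMeasurable.sub ?_ (hterm i).aestronglyMeasurable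
      exact ((hF.continuous_partialDeriv i).comp
        (continuous_pi fun i => (a i (ns k)).continuous_eval)).aestronglyMeasurable.smul
          ((a i (ns k)).continuous_grad c).aestronglyMeasurable
    · refine tendsto_eLpNorm_two_smul (C := C) (fun k => ?_)
        ((hF.continuous_partialDeriv i).comp_aestronglyMeasurable hUm) (fun k w => hC i _)
        (fun w => hC i _) ?_ (fun k => (a i (ns k)).memLp_grad c 2) (hV i)
        ((hga i).comp hns.tendsto_atTop)
      · exact ((hF.continuous_partialDeriv i).comp
          (continuous_pi fun i => (a i (ns k)).continuous_eval)).aestronglyMeasurable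
      · filter_upwards [hlim] with w hw
        exact ((hF.continuous_partialDeriv i).tendsto _).comp hw

/-! ### The Ornstein-Uhlenbeck structure in terms of the gradient -/

theorem integral_cylGamma_sub (hc : 0 ≤ c) (a b : Cylinder) :
    ∫ w, (cylGamma c a a w - 2 * cylGamma c a b w + cylGamma c b b w) ∂m =
      ∫ w, ⟪(a.grad c - b.grad c) w, (a.grad c - b.grad c) w⟫ ∂m := by
  congr 1
  funext w
  rw [cylGamma_eq_inner hc, cylGamma_eq_inner hc, cylGamma_eq_inner hc, Pi.sub_apply,
    real_inner_sub_sub_self]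

theorem Approximates.exists_grad [IsFiniteMeasure m] (hc : 0 ≤ c) {f : Path → ℝ}
    {a : ℕ → Cylinder} (h : Approximates c m a f) :
    ∃ V, MemLp V 2 m ∧ Tendsto (fun k => eLpNorm ((a k).grad c - V) 2 m) atTop (𝓝 0) := by
  refine exists_tendsto_eLpNorm_two (fun k => (a k).memLp_grad c 2) ?_
  rw [tendsto_eLpNorm_two_zero_iff
    fun q : ℕ × ℕ => ((a q.1).memLp_grad c 2).sub ((a q.2).memLp_grad c 2)]
  exact h.cauchy.congr fun q => integral_cylGamma_sub hc _ _

theorem approximates_of_tendsto_grad [IsFiniteMeasure m] (hc : 0 ≤ c) {f : Path → ℝ}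
    {V : Path → GradSpace} {a : ℕ → Cylinder} (hV : MemLp V 2 m)
    (h1 : Tendsto (fun k => eLpNorm ((a k).eval - f) 2 m) atTop (𝓝 0))
    (h2 : Tendsto (fun k => eLpNorm ((a k).grad c - V) 2 m) atTop (𝓝 0)) :
    Approximates c m a f := by
  refine ⟨h1, ?_⟩
  have := tendsto_eLpNorm_two_sub_sub
    (fun k => ((a k).memLp_grad c 2).aestronglyMeasurable) hV.aestronglyMeasurable h2
  rw [tendsto_eLpNorm_two_zero_iff
    fun q : ℕ × ℕ => ((a q.1).memLp_grad c 2).sub ((a q.2).memLp_grad c 2)] at this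
  exact this.congr fun q => (integral_cylGamma_sub hc _ _).symm

/-- The domain of the Ornstein-Uhlenbeck structure is that of the closed gradient. -/
theorem mem_dom_ornsteinUhlenbeck_iff (hc : 0 ≤ c) {hm : IsProbabilityMeasure m}
    (f : Path → ℝ) : f ∈ (ornsteinUhlenbeck c m hm).Dom ↔ ∃ V, IsGrad c m f V := by
  constructor
  · rintro ⟨hf, a, ha⟩
    obtain ⟨V, hV, h⟩ := ha.exists_grad hc
    exact ⟨V, hf, hV, a, ha.tendsto, h⟩
  · rintro ⟨V, hf, hV, a, h1, h2⟩
    exact ⟨hf, a, approximates_of_tendsto_grad hc hV h1 h2⟩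

/-- If gradients are unique, the squared field operator is the inner product of gradients. -/
theorem gamma_ornsteinUhlenbeck (hc : 0 ≤ c) {hm : IsProbabilityMeasure m}
    (huniq : ∀ {f V W}, IsGrad c m f V → IsGrad c m f W → V =ᵐ[m] W)
    {f h : Path → ℝ} {V W : Path → GradSpace} (hf : IsGrad c m f V) (hh : IsGrad c m h W) :
    (ornsteinUhlenbeck c m hm).Γ f h =ᵐ[m] fun w => ⟪V w, W w⟫ := by
  have lim : ∀ {a b : ℕ → Cylinder} {V W : Path → GradSpace}, MemLp V 2 m → MemLp W 2 m →
      Tendsto (fun k => eLpNorm ((a k).grad c - V) 2 m) atTop (𝓝 0) →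
      Tendsto (fun k => eLpNorm ((b k).grad c - W) 2 m) atTop (𝓝 0) →
      Tendsto (fun k => eLpNorm (cylGamma c (a k) (b k) - fun w => ⟪V w, W w⟫) 1 m)
        atTop (𝓝 0) := by
    intro a b V W hV hW h1 h2
    refine (tendsto_eLpNorm_one_inner (fun k => (a k).memLp_grad c 2)
      (fun k => (b k).memLp_grad c 2) hV hW h1 h2).congr fun k => ?_
    congr 2
    funext w
    exact (cylGamma_eq_inner hc _ _ _).symm
  have H : ∃ g, IsGamma c m f h g := by
    obtain ⟨-, hV, a, a1, a2⟩ := hf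
    obtain ⟨-, hW, b, b1, b2⟩ := hh
    exact ⟨_, hV.integrable_real_inner hW, a, b, approximates_of_tendsto_grad hc hV a1 a2,
      approximates_of_tendsto_grad hc hW b1 b2, lim hV hW a2 b2⟩
  have e : (ornsteinUhlenbeck c m hm).Γ f h = H.choose := dif_pos H
  rw [e]
  obtain ⟨hint, a, b, ha, hb, hlim⟩ := H.choose_spec
  obtain ⟨V', hV', ha'⟩ := ha.exists_grad hc
  obtain ⟨W', hW', hb'⟩ := hb.exists_grad hc
  have hVV := huniq hf ⟨hf.1, hV', a, ha.tendsto, ha'⟩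
  have hWW := huniq hh ⟨hh.1, hW', b, hb.tendsto, hb'⟩
  have hint' := hV'.integrable_real_inner hW'
  have hmeas : ∀ k, AEStronglyMeasurable (cylGamma c (a k) (b k)) m := fun k => by
    have : cylGamma c (a k) (b k) = fun w => ⟪(a k).grad c w, (b k).grad c w⟫ :=
      funext fun w => cylGamma_eq_inner hc _ _ _
    rw [this]
    exact (((a k).continuous_grad c).inner ((b k).continuous_grad c)).aestronglyMeasurable
  have hlim' := lim hV' hW' ha' hb'
  have heq : H.choose =ᵐ[m] fun w => ⟪V' w, W' w⟫ :=
    tendstoInMeasure_ae_unique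
      (tendstoInMeasure_of_tendsto_eLpNorm one_ne_zero hmeas hint.aestronglyMeasurable hlim)
      (tendstoInMeasure_of_tendsto_eLpNorm one_ne_zero hmeas hint'.aestronglyMeasurable hlim')
  filter_upwards [heq, hVV, hWW] with w h1 h2 h3
  rw [h1, h2, h3]

end WienerSpace

/-! ### Gaussian integration by parts -/

section GaussianIntegrationByParts

/-- Gaussian integration by parts on the line. -/
theorem integral_id_mul_gaussianReal {v : NNReal} {g g' : ℝ → ℝ}
    (hg : ∀ x, HasDerivAt g (g' x) x) (hi : Integrable g (gaussianReal 0 v))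
    (hxi : Integrable (fun x => x * g x) (gaussianReal 0 v))
    (hi' : Integrable g' (gaussianReal 0 v)) :
    ∫ x, x * g x ∂gaussianReal 0 v = v * ∫ x, g' x ∂gaussianReal 0 v := by
  by_cases hv : v = 0
  · simp [hv]
  have hv' : (v : ℝ) ≠ 0 := by exact_mod_cast hv
  have conv : ∀ {f : ℝ → ℝ}, Integrable f (gaussianReal 0 v) →
      Integrable fun x => gaussianPDFReal 0 v x * f x := by
    intro f hf
    rw [gaussianReal_of_var_ne_zero 0 hv, integrable_withDensity_iff_integrable_smul'
      (measurable_gaussianPDF 0 v) (ae_of_all _ fun x => gaussianPDF_lt_top)] at hf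
    simpa using hf
  have hpdf : ∀ x, HasDerivAt (gaussianPDFReal 0 v) (-(x / v) * gaussianPDFReal 0 v x) x := by
    intro x
    have h1 : HasDerivAt (fun x : ℝ => -(x - 0) ^ 2 / (2 * v)) (-(x / v)) x := by
      have := (((hasDerivAt_id x).sub_const 0).pow 2).neg.div_const (2 * (v : ℝ))
      refine this.congr_deriv ?_
      simp only [id, sub_zero]
      field_simp
      simp
    have h2 := (h1.exp).const_mul (√(2 * Real.pi * v))⁻¹
    rw [gaussianPDFReal_def]
    exact h2.congr_deriv (by ring)
  have hd : ∀ x, HasDerivAt (fun x => gaussianPDFReal 0 v x * g x)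
      (gaussianPDFReal 0 v x * g' x - (v : ℝ)⁻¹ * (gaussianPDFReal 0 v x * (x * g x))) x := by
    intro x
    refine ((hpdf x).mul (hg x)).congr_deriv ?_
    ring
  have h0 := integral_eq_zero_of_hasDerivAt_of_integrable hd
    ((conv hi').sub ((conv hxi).const_mul _)) (conv hi)
  rw [integral_sub (conv hi') ((conv hxi).const_mul _), integral_const_mul] at h0
  simp only [integral_gaussianReal_eq_integral_smul hv, smul_eq_mul]
  rw [sub_eq_zero.1 h0, mul_inv_cancel_left₀ hv']

variable {Ω : Type*} [MeasurableSpace Ω] {P : Measure Ω}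
  {E : Type*} [NormedAddCommGroup E] [NormedSpace ℝ E]

theorem MeasureTheory.MemLp.smul_const_right {Y : Ω → ℝ} (hY : MemLp Y 2 P) (α : E) :
    MemLp (fun ω => Y ω • α) 2 P :=
  MemLp.of_le_mul (c := ‖α‖) hY (hY.aestronglyMeasurable.smul_const α)
    (ae_of_all _ fun ω => by rw [norm_smul, mul_comm])

/-- The functions in Gaussian integration by parts are integrable as soon as they grow at most
linearly. -/
theorem integrable_mul_comp_of_linear_growth [IsFiniteMeasure P] {E : Type*}
    [NormedAddCommGroup E] {X : Ω → E} {Y : Ω → ℝ} (hX : MemLp X 2 P)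
    (hY : MemLp Y 2 P) {Φ : E → ℝ} {C : ℝ} (hΦ : Continuous Φ)
    (hC : ∀ x, |Φ x| ≤ C * (1 + ‖x‖)) :
    MemLp (fun ω => Φ (X ω)) 2 P ∧ Integrable (fun ω => Y ω * Φ (X ω)) P := by
  have h1 : MemLp (fun _ : Ω => (1 : ℝ)) 2 P := memLp_const 1
  have hX1 : MemLp (fun ω => C * (1 + ‖X ω‖)) 2 P := (h1.add hX.norm).const_mul C
  have h : MemLp (fun ω => Φ (X ω)) 2 P :=
    MemLp.mono' hX1 (hΦ.comp_aestronglyMeasurable hX.aestronglyMeasurable)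
      (ae_of_all _ fun ω => hC _)
  exact ⟨h, hY.integrable_mul h⟩

theorem integral_id_mul_comp_gaussianReal {v : NNReal} (r α : E) {Φ : E → ℝ} {C : ℝ}
    (hΦ : ContDiff ℝ 1 Φ) (hC : ∀ x, |Φ x| ≤ C * (1 + ‖x‖))
    (hC' : ∀ x, |fderiv ℝ Φ x α| ≤ C * (1 + ‖x‖)) :
    ∫ y, y * Φ (r + y • α) ∂gaussianReal 0 v =
      v * ∫ y, fderiv ℝ Φ (r + y • α) α ∂gaussianReal 0 v := by
  have hid : MemLp (fun y : ℝ => y) 2 (gaussianReal 0 v) := memLp_id_gaussianReal' 2 (by simp)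
  have hX : MemLp (fun y => r + y • α) 2 (gaussianReal 0 v) :=
    (memLp_const r).add (hid.smul_const_right α)
  have h1 := integrable_mul_comp_of_linear_growth hX hid hΦ.continuous hC
  have h2 := integrable_mul_comp_of_linear_growth hX hid
    (Φ := fun x => fderiv ℝ Φ x α)
    ((hΦ.continuous_fderiv (by norm_num)).clm_apply continuous_const) hC'
  refine integral_id_mul_gaussianReal (g := fun y => Φ (r + y • α))
    (g' := fun y => fderiv ℝ Φ (r + y • α) α)
    (fun y => ?_) (h1.1.integrable (by norm_num)) h1.2 (h2.1.integrable (by norm_num))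
  have h1 : HasDerivAt (fun y => r + y • α) α y := by
    have := ((hasDerivAt_id y).smul_const α).const_add r
    simpa using this
  exact ((hΦ.differentiable (by norm_num)) (r + y • α)).hasFDerivAt.comp_hasDerivAt y h1

/-- Gaussian integration by parts in the direction `α` of a Gaussian component `Y` which is
independent of the remainder `R`. -/
theorem integral_mul_comp_of_indepFun [IsProbabilityMeasure P] [MeasurableSpace E] [BorelSpace E]
    {R : Ω → E} {Y : Ω → ℝ} {v : NNReal} {α : E} {Φ : E → ℝ}
    {C : ℝ} (hind : IndepFun R Y P) (hR : MemLp R 2 P) (hYm : AEMeasurable Y P)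
    (hY : P.map Y = gaussianReal 0 v)
    (hΦ : ContDiff ℝ 1 Φ) (hC : ∀ x, |Φ x| ≤ C * (1 + ‖x‖))
    (hC' : ∀ x, |fderiv ℝ Φ x α| ≤ C * (1 + ‖x‖)) :
    ∫ ω, Y ω * Φ (R ω + Y ω • α) ∂P = v * ∫ ω, fderiv ℝ Φ (R ω + Y ω • α) α ∂P := by
  have hΦ' : Continuous fun x => fderiv ℝ Φ x α :=
    (hΦ.continuous_fderiv (by norm_num)).clm_apply continuous_const
  have hY2 : MemLp Y 2 P := by
    have : MemLp id 2 (P.map Y) := by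
      rw [hY]
      exact memLp_id_gaussianReal' 2 (by simp)
    exact (memLp_map_measure_iff aestronglyMeasurable_id hYm).1 this
  have hX : MemLp (fun ω => R ω + Y ω • α) 2 P := hR.add (hY2.smul_const_right α)
  have hRm : AEMeasurable R P := hR.aestronglyMeasurable.aemeasurable
  have hmap := (indepFun_iff_map_prod_eq_prod_map_map hRm hYm).1 hind
  rw [hY] at hmap
  have hRY : AEMeasurable (fun ω => (R ω, Y ω)) P := hRm.prodMk hYm
  have : IsProbabilityMeasure (P.map R) := Measure.isProbabilityMeasure_map hRm
  have hT : Continuous fun z : E × ℝ => z.1 + z.2 • α :=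
    continuous_fst.add (continuous_snd.smul continuous_const)
  have hf : Continuous fun z : E × ℝ => z.2 * Φ (z.1 + z.2 • α) :=
    continuous_snd.mul (hΦ.continuous.comp hT)
  have hf' : Continuous fun z : E × ℝ => fderiv ℝ Φ (z.1 + z.2 • α) α := hΦ'.comp hT
  have hfi : Integrable (fun z : E × ℝ => z.2 * Φ (z.1 + z.2 • α))
      ((P.map R).prod (gaussianReal 0 v)) := by
    rw [← hmap, integrable_map_measure hf.aestronglyMeasurable hRY]
    exact (integrable_mul_comp_of_linear_growth hX hY2 hΦ.continuous hC).2
  have hfi' : Integrable (fun z : E × ℝ => fderiv ℝ Φ (z.1 + z.2 • α) α)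
      ((P.map R).prod (gaussianReal 0 v)) := by
    rw [← hmap, integrable_map_measure hf'.aestronglyMeasurable hRY]
    exact (integrable_mul_comp_of_linear_growth hX hY2 hΦ' hC').1.integrable (by norm_num)
  have e1 : ∫ ω, Y ω * Φ (R ω + Y ω • α) ∂P =
      ∫ z : E × ℝ, z.2 * Φ (z.1 + z.2 • α) ∂((P.map R).prod (gaussianReal 0 v)) := by
    rw [← hmap, integral_map hRY hf.aestronglyMeasurable]
  have e2 : ∫ ω, fderiv ℝ Φ (R ω + Y ω • α) α ∂P =
      ∫ z : E × ℝ, fderiv ℝ Φ (z.1 + z.2 • α) α ∂((P.map R).prod (gaussianReal 0 v)) := by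
    rw [← hmap, integral_map hRY hf'.aestronglyMeasurable]
  rw [e1, e2, integral_prod _ hfi, integral_prod _ hfi', ← integral_const_mul]
  refine integral_congr_ae (ae_of_all _ fun r => ?_)
  exact integral_id_mul_comp_gaussianReal r α hΦ hC hC'

/-- Gaussian integration by parts: `E[X_t Φ(X_s)] = ∑ᵢ Cov(X_{sᵢ}, X_t) E[∂ᵢΦ(X_s)]` for a Gaussian
process `X` with `X_t` centered.  The regression of `X_s` on `X_t` splits off a remainder which is
independent of `X_t`. -/
theorem ProbabilityTheory.IsGaussianProcess.integral_mul_comp [IsProbabilityMeasure P]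
    {T : Type*} {X : T → Ω → ℝ}
    (hX : IsGaussianProcess X P) {ι : Type*} [Fintype ι] (s : ι → T) (t : T)
    (ht : ∫ ω, X t ω ∂P = 0) {Φ : (ι → ℝ) → ℝ} {C : ℝ} (hΦ : ContDiff ℝ 1 Φ)
    (hC : ∀ x, |Φ x| ≤ C * (1 + ‖x‖)) (hC' : ∀ x, ‖fderiv ℝ Φ x‖ ≤ C * (1 + ‖x‖)) :
    ∫ ω, X t ω * Φ (fun i => X (s i) ω) ∂P =
      ∫ ω, fderiv ℝ Φ (fun i => X (s i) ω) (fun i => cov[X (s i), X t; P]) ∂P := by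
  classical
  have hmem : ∀ u, MemLp (X u) 2 P := fun u => (hX.hasGaussianLaw_eval u).memLp (by simp)
  by_cases hv : Var[X t; P] = 0
  · have hz : X t =ᵐ[P] 0 := by
      have := ae_eq_integral_of_variance_eq_zero (hmem t) hv
      rw [ht] at this
      exact this
    have hcov : (fun i => cov[X (s i), X t; P]) = 0 := by
      funext i
      have : cov[X (s i), X t; P] = cov[X (s i), 0; P] := by
        refine integral_congr_ae ?_
        rw [integral_congr_ae hz]
        filter_upwards [hz] with ω hω
        rw [hω]
      rw [this, covariance_zero_right, Pi.zero_apply]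
    rw [hcov]
    simp only [map_zero, integral_zero]
    rw [← integral_zero Ω ℝ (μ := P)]
    refine integral_congr_ae ?_
    filter_upwards [hz] with ω hω
    simp [hω]
  · let α : ι → ℝ := fun i => cov[X (s i), X t; P] / Var[X t; P]
    let R : ι → Ω → ℝ := fun i ω => X (s i) ω - α i * X t ω
    have hRmem : ∀ i, MemLp (R i) 2 P := fun i => (hmem _).sub ((hmem t).const_mul _)
    have hproc : IsGaussianProcess (Sum.elim R fun _ : Unit => X t) P := by
      refine hX.of_isGaussianProcess fun j => ?_
      rcases j with i | j
      · refine ⟨{s i, t}, ContinuousLinearMap.proj ⟨s i, by simp⟩ -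
          α i • ContinuousLinearMap.proj ⟨t, by simp⟩, fun ω => ?_⟩
        simp [R]
      · exact ⟨{t}, ContinuousLinearMap.proj ⟨t, by simp⟩, fun ω => by simp⟩
    have hind : IndepFun (fun ω i => R i ω) (fun ω (_ : Unit) => X t ω) P := by
      refine hproc.indepFun_of_covariance_eq_zero
        (fun i => (hRmem i).aestronglyMeasurable.aemeasurable)
        (fun _ => hX.aemeasurable t) fun i _ => ?_
      have e : R i = X (s i) - fun ω => α i * X t ω := rfl
      rw [e, covariance_sub_left (hmem _) ((hmem t).const_mul _) (hmem t),
        covariance_const_mul_left, covariance_self (hX.aemeasurable t)]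
      simp only [α]
      field_simp
      ring
    have hind' : IndepFun (fun ω i => R i ω) (X t) P :=
        hind.comp (φ := id) (ψ := fun y : Unit → ℝ => y ()) measurable_id (measurable_pi_apply ())
    have hlaw : P.map (X t) = gaussianReal 0 Var[X t; P].toNNReal := by
      rw [(hX.hasGaussianLaw_eval t).map_eq_gaussianReal, ht]
    have hmax : ∀ x : ι → ℝ, 0 ≤ 1 + ‖x‖ := fun x => by positivity
    have key := integral_mul_comp_of_indepFun (α := α) (C := max C (C * ‖α‖)) hind'
      (MemLp.of_eval hRmem) (hX.aemeasurable t) hlaw hΦ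
      (fun x => (hC x).trans (mul_le_mul_of_nonneg_right (le_max_left _ _) (hmax x)))
      (fun x => ((fderiv ℝ Φ x).le_opNorm α).trans
        ((mul_le_mul_of_nonneg_right (hC' x) (norm_nonneg α)).trans (by
          rw [mul_right_comm]
          exact mul_le_mul_of_nonneg_right (le_max_right _ _) (hmax x))))
    have e : ∀ ω, (fun i => R i ω) + X t ω • α = fun i => X (s i) ω := fun ω => by
      funext i
      simp only [R, Pi.add_apply, Pi.smul_apply, smul_eq_mul]
      ring
    simp_rw [e] at key
    rw [key, Real.coe_toNNReal _ (variance_nonneg _ _), ← integral_const_mul]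
    congr 1
    funext ω
    rw [← smul_eq_mul, ← map_smul]
    congr 1
    funext i
    simp only [Pi.smul_apply, smul_eq_mul, α]
    field_simp

end GaussianIntegrationByParts

/-! ### Uniqueness of the gradient on Wiener space -/

namespace WienerSpace

section Separation

/-- The pairing `∑ᵢ ξᵢ w(tᵢ)` of a path with a finitely supported family of coefficients. -/
def pairing : Path →ₗ[ℝ] (unitInterval →₀ ℝ) →ₗ[ℝ] ℝ :=
  LinearMap.mk₂ ℝ (fun w ξ => ξ.sum fun t a => a * w t)
    (fun w w' ξ => by simp [Finsupp.sum, mul_add, Finset.sum_add_distrib])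
    (fun r w ξ => by simp [Finsupp.sum, Finset.mul_sum, mul_left_comm])
    (fun w ξ ξ' => Finsupp.sum_add_index' (by simp) (by intros; ring))
    (fun r w ξ => by
      rw [Finsupp.sum_smul_index (by simp)]
      simp [Finsupp.sum, Finset.mul_sum, mul_assoc])

theorem pairing_apply (w : Path) (ξ : unitInterval →₀ ℝ) :
    pairing w ξ = ∑ t ∈ ξ.support, ξ t * w t := rfl

theorem continuous_pairing (ξ : unitInterval →₀ ℝ) : Continuous fun w => pairing w ξ :=
  continuous_finsetSum _ fun t _ =>
    continuous_const.mul (ContinuousEvalConst.continuous_eval_const t)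

/-- Finite measures on the path space with the same finite-dimensional characteristic functions
are equal. -/
theorem measure_ext_of_pairing {μ ν : Measure Path} [IsFiniteMeasure μ] [IsFiniteMeasure ν]
    (h : ∀ ξ, ∫ w, Complex.exp (pairing w ξ * Complex.I) ∂μ =
      ∫ w, Complex.exp (pairing w ξ * Complex.I) ∂ν) : μ = ν := by
  let _ : TopologicalSpace (unitInterval →₀ ℝ) := ⊥
  have : DiscreteTopology (unitInterval →₀ ℝ) := ⟨rfl⟩
  refine ext_of_integral_char_eq (W := unitInterval →₀ ℝ) (L := pairing)
    Real.continuous_probChar Real.probChar_ne_one (fun w hw h0 => hw ?_)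
    (continuous_prod_of_discrete_right.2 continuous_pairing) fun ξ => ?_
  · ext t
    have := LinearMap.congr_fun h0 (Finsupp.single t 1)
    rw [pairing, LinearMap.mk₂_apply, Finsupp.sum_single_index (by simp)] at this
    simpa using this
  · simpa only [BoundedContinuousFunction.char_apply, Real.probChar_apply] using h ξ

theorem isC1Lip_cos_clm {q : ℕ} (ℓ : (Fin q → ℝ) →L[ℝ] ℝ) : IsC1Lip fun x => Real.cos (ℓ x) :=
  ⟨Real.contDiff_cos.comp ℓ.contDiff, _, Real.lipschitzWith_cos.comp ℓ.lipschitz⟩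

theorem isC1Lip_sin_clm {q : ℕ} (ℓ : (Fin q → ℝ) →L[ℝ] ℝ) : IsC1Lip fun x => Real.sin (ℓ x) :=
  ⟨Real.contDiff_sin.comp ℓ.contDiff, _, Real.lipschitzWith_sin.comp ℓ.lipschitz⟩

/-- Bounded cylinder functions separate integrable functions: the trigonometric ones determine
the finite measures with densities `f⁺` and `f⁻`. -/
theorem ae_eq_zero_of_forall_cylinder {m : Measure Path} [IsFiniteMeasure m] {f : Path → ℝ}
    (hf : Integrable f m)
    (h : ∀ a : Cylinder, (∃ C, ∀ x, |a.φ x| ≤ C) → ∫ w, f w * a.eval w ∂m = 0) :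
    f =ᵐ[m] 0 := by
  have hlin : ∀ ξ : unitInterval →₀ ℝ, ∃ (q : ℕ) (t : Fin q → unitInterval)
      (ℓ : (Fin q → ℝ) →L[ℝ] ℝ), ∀ w : Path, ℓ (fun i => w (t i)) = pairing w ξ := by
    intro ξ
    let e := ξ.support.equivFin
    refine ⟨ξ.support.card, fun i => e.symm i,
      ∑ i : Fin ξ.support.card, ξ (e.symm i) • ContinuousLinearMap.proj i, fun w => ?_⟩
    rw [pairing_apply, ← Finset.sum_coe_sort ξ.support, ← e.symm.sum_comp]
    simp
  have hcos : ∀ ξ, ∫ w, f w * Real.cos (pairing w ξ) ∂m = 0 := by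
    intro ξ
    obtain ⟨q, t, ℓ, hℓ⟩ := hlin ξ
    have := h ⟨q, t, _, isC1Lip_cos_clm ℓ⟩ ⟨1, fun x => Real.abs_cos_le_one _⟩
    simp_rw [← hℓ]
    exact this
  have hsin : ∀ ξ, ∫ w, f w * Real.sin (pairing w ξ) ∂m = 0 := by
    intro ξ
    obtain ⟨q, t, ℓ, hℓ⟩ := hlin ξ
    have := h ⟨q, t, _, isC1Lip_sin_clm ℓ⟩ ⟨1, fun x => Real.abs_sin_le_one _⟩
    simp_rw [← hℓ]
    exact this
  have hfin : ∀ g : Path → ℝ, Integrable g m →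
      IsFiniteMeasure (m.withDensity fun w => ENNReal.ofReal (g w)) := fun g hg =>
    isFiniteMeasure_withDensity_ofReal hg.2
  have := hfin f hf
  have := hfin (-f) hf.neg
  have hexp : ∀ ξ, Integrable (fun w => (f w : ℂ) * Complex.exp (pairing w ξ * Complex.I)) m := by
    intro ξ
    refine hf.ofReal.mul_bdd (c := 1) ?_ (ae_of_all _ fun w => ?_)
    · exact (Complex.continuous_exp.comp ((Complex.continuous_ofReal.comp
        (continuous_pairing ξ)).mul continuous_const)).aestronglyMeasurable
    · rw [Complex.norm_exp_ofReal_mul_I]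
  have hzero : ∀ ξ, ∫ w, (f w : ℂ) * Complex.exp (pairing w ξ * Complex.I) ∂m = 0 := by
    intro ξ
    rw [← integral_re_add_im (𝕜 := ℂ) (hexp ξ)]
    have e1 : ∀ w, RCLike.re ((f w : ℂ) * Complex.exp (pairing w ξ * Complex.I)) =
        f w * Real.cos (pairing w ξ) := fun w => by
      simp [Complex.exp_ofReal_mul_I_re]
    have e2 : ∀ w, RCLike.im ((f w : ℂ) * Complex.exp (pairing w ξ * Complex.I)) =
        f w * Real.sin (pairing w ξ) := fun w => by
      simp [Complex.exp_ofReal_mul_I_im]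
    simp_rw [e1, e2, hcos, hsin]
    simp
  have hm : m.withDensity (fun w => ENNReal.ofReal (f w)) =
      m.withDensity (fun w => ENNReal.ofReal ((-f) w)) := by
    refine measure_ext_of_pairing fun ξ => ?_
    have hb : ∀ g : Path → ℝ, Integrable g m →
        Integrable (fun w => (ENNReal.ofReal (g w)).toReal •
          Complex.exp (pairing w ξ * Complex.I)) m := by
      intro g hg
      have : Integrable (fun w => (ENNReal.ofReal (g w)).toReal) m := by
        simpa [ENNReal.toReal_ofReal'] using hg.pos_part
      refine (this.ofReal (𝕜 := ℂ)).mul_bdd (c := 1) ?_ (ae_of_all _ fun w => ?_)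
      · exact (Complex.continuous_exp.comp ((Complex.continuous_ofReal.comp
          (continuous_pairing ξ)).mul continuous_const)).aestronglyMeasurable
      · rw [Complex.norm_exp_ofReal_mul_I]
    rw [integral_withDensity_eq_integral_toReal_smul₀ hf.aemeasurable.ennreal_ofReal (by simp),
      integral_withDensity_eq_integral_toReal_smul₀ hf.neg.aemeasurable.ennreal_ofReal (by simp),
      ← sub_eq_zero, ← integral_sub (hb f hf) (hb (-f) hf.neg), ← hzero ξ]
    congr 1
    funext w
    rw [← sub_smul, ENNReal.toReal_ofReal', ENNReal.toReal_ofReal', Pi.neg_apply,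
      Complex.real_smul]
    congr 2
    rcases le_total 0 (f w) with h0 | h0
    · rw [max_eq_left h0, max_eq_right (by linarith), sub_zero]
    · rw [max_eq_right h0, max_eq_left (by linarith)]
      ring
  rw [withDensity_eq_iff hf.aemeasurable.ennreal_ofReal hf.neg.aemeasurable.ennreal_ofReal
    (by
      have := measure_ne_top (m.withDensity fun w => ENNReal.ofReal (f w)) Set.univ
      rwa [withDensity_apply _ MeasurableSet.univ, Measure.restrict_univ] at this)] at hm
  filter_upwards [hm] with w hw
  rcases le_total 0 (f w) with h0 | h0
  · rw [ENNReal.ofReal_of_nonpos (p := (-f) w) (by simpa using h0),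
      ENNReal.ofReal_eq_zero] at hw
    exact le_antisymm hw h0
  · rw [ENNReal.ofReal_of_nonpos h0, eq_comm, ENNReal.ofReal_eq_zero] at hw
    exact le_antisymm h0 (by simpa using hw)

end Separation

variable {c v : ℝ} {m : Measure Path}

/-- Cylinder functions are dense in `L²(m)`, as a square integrable function orthogonal to all of
them vanishes. -/
theorem exists_isGrad_eLpNorm_lt [IsProbabilityMeasure m] (hW : IsWienerMeasure v m)
    (f : Path → ℝ) (hf : MemLp f 2 m) (ε : ENNReal) (hε : 0 < ε) :
    ∃ g V, IsGrad c m g V ∧ eLpNorm (f - g) 2 m < ε := by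
  let K : Submodule ℝ (Lp ℝ 2 m) := Submodule.span ℝ
    (Set.range fun a : Cylinder => (hW.memLp_eval a (p := 2) (by simp)).toLp a.eval)
  have hK : ∀ g ∈ K, ∃ a : Cylinder, g =ᵐ[m] a.eval := by
    intro g hg
    induction hg using Submodule.span_induction with
    | mem g hg =>
      obtain ⟨a, rfl⟩ := hg
      exact ⟨a, MemLp.coeFn_toLp _⟩
    | zero =>
      exact ⟨⟨0, Fin.elim0, fun _ => 0, contDiff_const, 0, LipschitzWith.const _⟩,
        Lp.coeFn_zero _ _ _⟩
    | add g h _ _ ihg ihh =>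
      obtain ⟨a, ha⟩ := ihg
      obtain ⟨b, hb⟩ := ihh
      obtain ⟨d, hd, -⟩ := Cylinder.exists_comp ![a, b]
        (F := fun x => (ContinuousLinearMap.proj (R := ℝ) (φ := fun _ : Fin 2 => ℝ) 0 +
          ContinuousLinearMap.proj (R := ℝ) (φ := fun _ : Fin 2 => ℝ) 1) x) (isC1Lip_clm _)
      refine ⟨d, ?_⟩
      filter_upwards [Lp.coeFn_add g h, ha, hb] with w h1 h2 h3
      rw [h1, Pi.add_apply, h2, h3, hd]
      simp
    | smul r g _ ihg =>
      obtain ⟨a, ha⟩ := ihg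
      obtain ⟨d, hd, -⟩ := Cylinder.exists_comp ![a]
        (F := fun x => (r • ContinuousLinearMap.proj (R := ℝ) (φ := fun _ : Fin 1 => ℝ) 0) x)
        (isC1Lip_clm _)
      refine ⟨d, ?_⟩
      filter_upwards [Lp.coeFn_smul r g, ha] with w h1 h2
      rw [h1, Pi.smul_apply, h2, hd]
      simp
  have htop : K.topologicalClosure = ⊤ := by
    rw [Submodule.topologicalClosure_eq_top_iff, Submodule.eq_bot_iff]
    intro g hg
    rw [Submodule.mem_orthogonal'] at hg
    refine (Lp.eq_zero_iff_ae_eq_zero).2 (ae_eq_zero_of_forall_cylinder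
      ((Lp.memLp g).integrable (by norm_num)) fun a _ => ?_)
    have := hg _ (Submodule.subset_span ⟨a, rfl⟩)
    rw [L2.inner_def] at this
    rw [← this]
    refine integral_congr_ae ?_
    filter_upwards [(hW.memLp_eval a (p := 2) (by simp)).coeFn_toLp] with w hw
    rw [hw]
    simp [mul_comm]
  have hmem : hf.toLp f ∈ closure (K : Set (Lp ℝ 2 m)) := by
    have : hf.toLp f ∈ K.topologicalClosure := by rw [htop]; trivial
    exact this
  obtain ⟨g, hg, hlt⟩ := EMetric.mem_closure_iff.1 hmem ε hε
  obtain ⟨a, ha⟩ := hK g hg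
  refine ⟨a.eval, a.grad c, isGrad_cylinder hW a, ?_⟩
  rw [Lp.edist_def] at hlt
  rwa [← eLpNorm_congr_ae ((hf.coeFn_toLp).sub ha)]

theorem inner_grad_timeVec (a : Cylinder) (t : unitInterval) (w : Path) :
    ⟪a.grad c w, timeVec t⟫ =
      √c * fderiv ℝ a.φ (a.coords w) (fun i => min (a.t i : ℝ) (t : ℝ)) := by
  rw [Cylinder.grad, real_inner_smul_left, sum_inner, fderiv_apply_eq_sum_partialDeriv]
  congr 1
  refine Finset.sum_congr rfl fun i _ => ?_
  rw [real_inner_smul_left, inner_timeVec, mul_comm]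

/-- Integration by parts on the Wiener space, for a product of two cylinder functions. -/
theorem IsWienerMeasure.integral_mul_eval [IsProbabilityMeasure m] (hW : IsWienerMeasure v m)
    (a b : Cylinder) {B : ℝ} (hB : ∀ x, |b.φ x| ≤ B) (t : unitInterval) :
    √c * ∫ w : Path, w t * (a.eval w * b.eval w) ∂m =
      v * ∫ w, (⟪a.grad c w, timeVec t⟫ * b.eval w + a.eval w * ⟪b.grad c w, timeVec t⟫) ∂m := by
  obtain ⟨Ka, hKa⟩ := a.isC1Lip.2
  obtain ⟨Kb, hKb⟩ := b.isC1Lip.2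
  have hB0 : 0 ≤ B := (abs_nonneg _).trans (hB 0)
  let π₁ : (Fin a.q ⊕ Fin b.q → ℝ) →L[ℝ] (Fin a.q → ℝ) :=
    ContinuousLinearMap.pi fun i => ContinuousLinearMap.proj (Sum.inl i)
  let π₂ : (Fin a.q ⊕ Fin b.q → ℝ) →L[ℝ] (Fin b.q → ℝ) :=
    ContinuousLinearMap.pi fun i => ContinuousLinearMap.proj (Sum.inr i)
  let Φ : (Fin a.q ⊕ Fin b.q → ℝ) → ℝ := fun x => a.φ (π₁ x) * b.φ (π₂ x)
  have hΦ : ContDiff ℝ 1 Φ :=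
    (a.isC1Lip.1.comp π₁.contDiff).mul (b.isC1Lip.1.comp π₂.contDiff)
  have hd : ∀ x, HasFDerivAt Φ (a.φ (π₁ x) • (fderiv ℝ b.φ (π₂ x)).comp π₂ +
      b.φ (π₂ x) • (fderiv ℝ a.φ (π₁ x)).comp π₁) x := fun x =>
    ((a.isC1Lip.differentiable _).hasFDerivAt.comp x π₁.hasFDerivAt).mul
      ((b.isC1Lip.differentiable _).hasFDerivAt.comp x π₂.hasFDerivAt)
  let A : ℝ := |a.φ 0| + Ka * ‖π₁‖
  have hA0 : 0 ≤ A := by positivity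
  have hA : ∀ x, |a.φ (π₁ x)| ≤ A * (1 + ‖x‖) := by
    intro x
    have h1 : |a.φ (π₁ x) - a.φ 0| ≤ Ka * ‖π₁ x‖ := by
      simpa [Real.dist_eq] using hKa.dist_le_mul (π₁ x) 0
    have h2 : (Ka : ℝ) * ‖π₁ x‖ ≤ Ka * (‖π₁‖ * ‖x‖) :=
      mul_le_mul_of_nonneg_left (π₁.le_opNorm x) Ka.2
    have h3 : |a.φ (π₁ x)| ≤ |a.φ (π₁ x) - a.φ 0| + |a.φ 0| := by
      simpa using abs_add_le (a.φ (π₁ x) - a.φ 0) (a.φ 0)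
    have h4 : 0 ≤ |a.φ 0| * ‖x‖ := by positivity
    have h5 : 0 ≤ (Ka : ℝ) * ‖π₁‖ := by positivity
    simp only [A]
    nlinarith
  let C : ℝ := A * B + A * (Kb * ‖π₂‖) + B * (Ka * ‖π₁‖)
  have hC : ∀ x, |Φ x| ≤ C * (1 + ‖x‖) := by
    intro x
    have h1 : |Φ x| ≤ A * (1 + ‖x‖) * B := by
      rw [abs_mul]
      exact mul_le_mul (hA x) (hB _) (abs_nonneg _) (by positivity)
    refine h1.trans ?_
    rw [mul_right_comm]
    refine mul_le_mul_of_nonneg_right ?_ (by positivity)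
    have h2 : 0 ≤ A * (Kb * ‖π₂‖) := by positivity
    have h3 : 0 ≤ B * (Ka * ‖π₁‖) := by positivity
    simp only [C]
    linarith
  have hC' : ∀ x, ‖fderiv ℝ Φ x‖ ≤ C * (1 + ‖x‖) := by
    intro x
    have h1 : ‖(fderiv ℝ b.φ (π₂ x)).comp π₂‖ ≤ Kb * ‖π₂‖ :=
      (ContinuousLinearMap.opNorm_comp_le _ _).trans
        (mul_le_mul_of_nonneg_right (norm_fderiv_le_of_lipschitz ℝ hKb) (norm_nonneg _))
    have h2 : ‖(fderiv ℝ a.φ (π₁ x)).comp π₁‖ ≤ Ka * ‖π₁‖ :=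
      (ContinuousLinearMap.opNorm_comp_le _ _).trans
        (mul_le_mul_of_nonneg_right (norm_fderiv_le_of_lipschitz ℝ hKa) (norm_nonneg _))
    rw [(hd x).fderiv]
    refine (norm_add_le _ _).trans ?_
    rw [norm_smul, norm_smul]
    have h3 := mul_le_mul (hA x) h1 (norm_nonneg _) (by positivity)
    have h4 := mul_le_mul (hB (π₂ x)) h2 (norm_nonneg _) hB0
    have h5 : 0 ≤ A * B * (1 + ‖x‖) := by positivity
    have h6 : 0 ≤ B * (Ka * ‖π₁‖) * ‖x‖ := by positivity
    simp only [Real.norm_eq_abs, C]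
    nlinarith
  have key := hW.isGaussian.integral_mul_comp (Sum.elim a.t b.t) t (hW.mean t) hΦ hC hC'
  have e1 : ∀ w : Path, Φ (fun i => w (Sum.elim a.t b.t i)) = a.eval w * b.eval w := fun w => rfl
  have e2 : ∀ w : Path, √c * fderiv ℝ Φ (fun i => w (Sum.elim a.t b.t i))
      (fun i => cov[fun w : Path => w (Sum.elim a.t b.t i), fun w : Path => w t; m]) =
      v * (⟪a.grad c w, timeVec t⟫ * b.eval w + a.eval w * ⟪b.grad c w, timeVec t⟫) := by
    intro w
    simp_rw [hW.cov]
    have e3 : (fun i => v * min ((Sum.elim a.t b.t i : unitInterval) : ℝ) (t : ℝ)) =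
        v • fun i => min ((Sum.elim a.t b.t i : unitInterval) : ℝ) (t : ℝ) := rfl
    rw [e3, map_smul, (hd _).fderiv, inner_grad_timeVec, inner_grad_timeVec]
    simp only [add_apply, smul_apply,
      ContinuousLinearMap.comp_apply, smul_eq_mul]
    change √c * (v * (a.eval w * fderiv ℝ b.φ (b.coords w) (fun i => min (b.t i : ℝ) (t : ℝ)) +
      b.eval w * fderiv ℝ a.φ (a.coords w) (fun i => min (a.t i : ℝ) (t : ℝ)))) = _
    ring
  simp_rw [e1] at key
  rw [key, ← integral_const_mul, ← integral_const_mul]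
  exact integral_congr_ae (ae_of_all _ e2)

theorem tendsto_integral_inner_of_tendsto_eLpNorm_two {Ω H : Type*} [MeasurableSpace Ω]
    [NormedAddCommGroup H] [InnerProductSpace ℝ H] {P : Measure Ω}
    {V : ℕ → Ω → H} {V₀ G : Ω → H} (hV : ∀ k, MemLp (V k) 2 P) (hV₀ : MemLp V₀ 2 P)
    (hG : MemLp G 2 P) (h : Tendsto (fun k => eLpNorm (V k - V₀) 2 P) atTop (𝓝 0)) :
    Tendsto (fun k => ∫ ω, ⟪V k ω, G ω⟫ ∂P) atTop (𝓝 (∫ ω, ⟪V₀ ω, G ω⟫ ∂P)) :=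
  tendsto_integral_of_L1' _ (hV₀.integrable_real_inner hG).aestronglyMeasurable
    (Eventually.of_forall fun k => (hV k).integrable_real_inner hG)
    (tendsto_eLpNorm_one_inner hV (fun _ => hG) hV₀ hG h (by simp))

theorem memLp_eval_smul [IsFiniteMeasure m] {H : Type*} [NormedAddCommGroup H]
    [InnerProductSpace ℝ H] (b : Cylinder) {B : ℝ} (hB : ∀ x, |b.φ x| ≤ B) {V : Path → H}
    (hV : MemLp V 2 m) : MemLp (fun w => b.eval w • V w) 2 m :=
  MemLp.of_le_mul (c := B) hV
    (b.continuous_eval.aestronglyMeasurable.smul hV.aestronglyMeasurable) (ae_of_all _ fun w => by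
      rw [norm_smul]
      exact mul_le_mul_of_nonneg_right (hB _) (norm_nonneg _))

/-- Integration by parts for the closed gradient. -/
theorem IsGrad.integral_inner_timeVec [IsProbabilityMeasure m] (hW : IsWienerMeasure v m)
    {f : Path → ℝ} {V : Path → GradSpace} (h : IsGrad c m f V)
    (b : Cylinder) {B : ℝ} (hB : ∀ x, |b.φ x| ≤ B) (t : unitInterval) :
    v * ∫ w, ⟪V w, timeVec t⟫ * b.eval w ∂m =
      √c * ∫ w : Path, f w * (b.eval w * w t) ∂m -
        v * ∫ w, f w * ⟪b.grad c w, timeVec t⟫ ∂m := by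
  obtain ⟨hf, hV, a, ha, hga⟩ := h
  have hwt : MemLp (fun w : Path => w t) 2 m := hW.memLp_coord t (by simp)
  have hG1 : MemLp (fun w => b.eval w • timeVec t) 2 m := memLp_eval_smul b hB (memLp_const _)
  have hG2 : MemLp (fun w : Path => b.eval w * w t) 2 m := memLp_eval_smul b hB hwt
  have hG3 : MemLp (fun w => ⟪b.grad c w, timeVec t⟫) 2 m :=
    MemLp.of_le_mul (c := ‖timeVec t‖) (b.memLp_grad c 2)
      ((b.continuous_grad c).inner continuous_const).aestronglyMeasurable
      (ae_of_all _ fun w => (norm_inner_le_norm _ _).trans (le_of_eq (mul_comm _ _)))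
  have hae : ∀ k, MemLp (a k).eval 2 m := fun k => hW.memLp_eval _ (by simp)
  have t1 := tendsto_integral_inner_of_tendsto_eLpNorm_two
    (fun k => (a k).memLp_grad c 2) hV hG1 hga
  have t2 := tendsto_integral_inner_of_tendsto_eLpNorm_two hae hf hG2 ha
  have t3 := tendsto_integral_inner_of_tendsto_eLpNorm_two hae hf hG3 ha
  have hin : ∀ x y : ℝ, ⟪x, y⟫ = x * y := fun x y => by simp [mul_comm]
  simp only [real_inner_smul_right, hin] at t1 t2 t3
  have key : ∀ k, v * ∫ w, b.eval w * ⟪(a k).grad c w, timeVec t⟫ ∂m =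
      √c * ∫ w : Path, (a k).eval w * (b.eval w * w t) ∂m -
        v * ∫ w, (a k).eval w * ⟪b.grad c w, timeVec t⟫ ∂m := by
    intro k
    have h1 := hW.integral_mul_eval (c := c) (a k) b hB t
    have i1 : Integrable (fun w => ⟪(a k).grad c w, timeVec t⟫ * b.eval w) m := by
      have := ((a k).memLp_grad c 2).integrable_real_inner hG1
      simpa only [real_inner_smul_right, mul_comm] using this
    have i2 : Integrable (fun w => (a k).eval w * ⟪b.grad c w, timeVec t⟫) m :=
      (hae k).integrable_mul hG3
    rw [integral_add i1 i2] at h1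
    have e1 : ∀ w : Path, (a k).eval w * (b.eval w * w t) = w t * ((a k).eval w * b.eval w) :=
      fun w => by ring
    simp_rw [e1, h1, mul_comm (b.eval _)]
    ring
  simp_rw [mul_comm _ (b.eval _)] at t1 ⊢
  exact tendsto_nhds_unique (t1.const_mul v)
    (((t2.const_mul √c).sub (t3.const_mul v)).congr fun k => (key k).symm)

/-- The gradient on cylinder functions is closable: two gradients of `f` have the same integral
against test functions by integration by parts, and their difference is a limit of combinations of
the vectors `timeVec t`. -/
theorem IsGrad.unique [IsProbabilityMeasure m] (hW : IsWienerMeasure v m) (hcv : v ≠ 0 ∨ c = 0)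
    {f : Path → ℝ} {V W : Path → GradSpace} (hV : IsGrad c m f V) (hV' : IsGrad c m f W) :
    V =ᵐ[m] W := by
  have hZ : MemLp (V - W) 2 m := hV.2.1.sub hV'.2.1
  have horth : v ≠ 0 → ∀ t, (fun w => ⟪(V - W) w, timeVec t⟫) =ᵐ[m] 0 := by
    intro hv t
    have hi : ∀ {U : Path → GradSpace}, MemLp U 2 m →
        Integrable (fun w => ⟪U w, timeVec t⟫) m := fun hU =>
      hU.integrable_real_inner (memLp_const _)
    refine ae_eq_zero_of_forall_cylinder (hi hZ) fun b hb => ?_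
    obtain ⟨B, hB⟩ := hb
    have h1 := hV.integral_inner_timeVec hW b hB t
    have h2 := hV'.integral_inner_timeVec hW b hB t
    have h3 := mul_left_cancel₀ hv (h1.trans h2.symm)
    have hib : ∀ {U : Path → GradSpace}, MemLp U 2 m →
        Integrable (fun w => ⟪U w, timeVec t⟫ * b.eval w) m := fun hU => by
      have := hU.integrable_real_inner (memLp_eval_smul b hB (memLp_const (timeVec t)))
      simpa only [real_inner_smul_right, mul_comm] using this
    simp_rw [Pi.sub_apply, inner_sub_left, sub_mul]
    rw [integral_sub (hib hV.2.1) (hib hV'.2.1), h3, sub_self]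
  have hcyl : ∀ a : Cylinder, ∫ w, ⟪a.grad c w, (V - W) w⟫ ∂m = 0 := by
    intro a
    rcases hcv with hv | hc
    · rw [← integral_zero Path ℝ (μ := m)]
      refine integral_congr_ae ?_
      filter_upwards [ae_all_iff.2 fun i => horth hv (a.t i)] with w hw
      rw [Cylinder.grad, real_inner_smul_left, sum_inner, Finset.sum_eq_zero, mul_zero]
      intro i _
      rw [real_inner_smul_left, real_inner_comm, hw i, Pi.zero_apply, mul_zero]
    · simp [Cylinder.grad, hc]
  obtain ⟨-, hVm, a, -, ha⟩ := hV
  obtain ⟨-, hWm, b, -, hb⟩ := hV'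
  have t1 := tendsto_integral_inner_of_tendsto_eLpNorm_two
    (fun k => (a k).memLp_grad c 2) hVm hZ ha
  have t2 := tendsto_integral_inner_of_tendsto_eLpNorm_two
    (fun k => (b k).memLp_grad c 2) hWm hZ hb
  simp_rw [hcyl] at t1 t2
  have e1 := tendsto_nhds_unique t1 tendsto_const_nhds
  have e2 := tendsto_nhds_unique t2 tendsto_const_nhds
  have e3 : ∫ w, ⟪(V - W) w, (V - W) w⟫ ∂m = 0 := by
    have h := integral_sub (hVm.integrable_real_inner hZ) (hWm.integrable_real_inner hZ)
    rw [e1, e2, sub_self] at h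
    rw [← h]
    simp_rw [← inner_sub_left]
    rfl
  rw [integral_eq_zero_iff_of_nonneg (fun w => real_inner_self_nonneg)
    (hZ.integrable_real_inner hZ)] at e3
  filter_upwards [e3] with w hw
  exact sub_eq_zero.1 (inner_self_eq_zero.1 hw)

theorem closedGradient_isGrad [IsProbabilityMeasure m] (hW : IsWienerMeasure v m)
    (hcv : v ≠ 0 ∨ c = 0) : ClosedGradient m (IsGrad c m) where
  memLp h := h.1
  memLp_grad h := h.2.1
  congr h hfg := h.congr hfg
  unique h h' := h.unique hW hcv h'
  closed h hf hV h1 h2 := IsGrad.closed hW h hf hV h1 h2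
  chain h hF := IsGrad.chain hW h hF
  dense f hf ε hε := exists_isGrad_eLpNorm_lt hW f hf ε hε

theorem isErrorStructure_ornsteinUhlenbeck (hc : 0 ≤ c) (hm : IsProbabilityMeasure m)
    (hW : IsWienerMeasure v m) (hcv : v ≠ 0 ∨ c = 0) :
    (ornsteinUhlenbeck c m hm).IsErrorStructure :=
  ClosedGradient.isErrorStructure (Gr := IsGrad c m) (closedGradient_isGrad hW hcv)
    (mem_dom_ornsteinUhlenbeck_iff hc)
    (gamma_ornsteinUhlenbeck hc fun h h' => h.unique hW hcv h')

theorem eval_mem_dom_ornsteinUhlenbeck (hc : 0 ≤ c) (hm : IsProbabilityMeasure m)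
    (hW : IsWienerMeasure v m) (a : Cylinder) : a.eval ∈ (ornsteinUhlenbeck c m hm).Dom :=
  (mem_dom_ornsteinUhlenbeck_iff hc _).2 ⟨_, isGrad_cylinder hW a⟩

theorem energy_ornsteinUhlenbeck_eval (hc : 0 ≤ c) (hm : IsProbabilityMeasure m)
    (hW : IsWienerMeasure v m) (hcv : v ≠ 0 ∨ c = 0) (a : Cylinder) :
    (ornsteinUhlenbeck c m hm).energy a.eval = (1 / 2) * ∫ w, cylGamma c a a w ∂m := by
  have h := gamma_ornsteinUhlenbeck (hm := hm) hc (fun h h' => h.unique hW hcv h')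
    (isGrad_cylinder hW a) (isGrad_cylinder hW a)
  rw [ErrorData.energy]
  congr 1
  refine (integral_congr_ae h).trans ?_
  simp_rw [cylGamma_eq_inner hc]

end WienerSpace

/-! ### Functions of finitely many coordinates in the product structure -/

section Update

variable {E : Type*} [MeasurableSpace E]

/-- Resampling one coordinate preserves an infinite power of a probability measure. -/
theorem measurePreserving_update_infinitePi (μ : Measure E) [IsProbabilityMeasure μ] (n : ℕ) :
    MeasurePreserving (fun z : (ℕ → E) × E => Function.update z.1 n z.2)
      ((Measure.infinitePi fun _ : ℕ => μ).prod μ) (Measure.infinitePi fun _ : ℕ => μ) := by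
  have hmeas : Measurable fun z : (ℕ → E) × E => Function.update z.1 n z.2 := by
    refine measurable_pi_lambda _ fun k => ?_
    by_cases hk : k = n
    · subst hk
      simpa using measurable_snd
    · simp only [Function.update_of_ne hk]
      fun_prop
  refine ⟨hmeas, Measure.eq_infinitePi _ fun s t ht => ?_⟩
  rw [Measure.map_apply hmeas (MeasurableSet.pi s.countable_toSet fun i _ => ht i)]
  by_cases hn : n ∈ s
  · have e : (fun z : (ℕ → E) × E => Function.update z.1 n z.2) ⁻¹' Set.pi s t =
        Set.pi (s.erase n : Finset ℕ) t ×ˢ t n := by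
      ext z
      simp only [Set.mem_preimage, Set.mem_pi, Set.mem_prod, Finset.coe_erase, Set.mem_sdiff,
        Finset.mem_coe, Set.mem_singleton_iff]
      constructor
      · intro h
        exact ⟨fun i hi => by simpa [Function.update_of_ne hi.2] using h i hi.1,
          by simpa using h n hn⟩
      · rintro ⟨h1, h2⟩ i hi
        by_cases hin : i = n
        · subst hin
          simpa using h2
        · simpa [Function.update_of_ne hin] using h1 i ⟨hi, hin⟩
    rw [e, Measure.prod_prod, Measure.infinitePi_pi _ fun i _ => ht i, mul_comm,
      Finset.mul_prod_erase s (fun i => μ (t i)) hn]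
  · have e : (fun z : (ℕ → E) × E => Function.update z.1 n z.2) ⁻¹' Set.pi s t =
        Set.pi s t ×ˢ Set.univ := by
      ext z
      simp only [Set.mem_preimage, Set.mem_pi, Set.mem_prod, Set.mem_univ, and_true,
        Finset.mem_coe]
      refine forall₂_congr fun i hi => ?_
      rw [Function.update_of_ne (ne_of_mem_of_not_mem hi hn)]
    rw [e, Measure.prod_prod, Measure.infinitePi_pi _ fun i _ => ht i, measure_univ, mul_one]

/-- Functions on the infinite product with almost everywhere equal sections in one coordinate are
almost everywhere equal. -/
theorem ae_eq_of_coordSection_ae_eq {μ : Measure E} [IsProbabilityMeasure μ] {n : ℕ}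
    {g g' : (ℕ → E) → ℝ} (hg : AEStronglyMeasurable g (Measure.infinitePi fun _ : ℕ => μ))
    (hg' : AEStronglyMeasurable g' (Measure.infinitePi fun _ : ℕ => μ))
    (h : ∀ᵐ ω ∂Measure.infinitePi fun _ : ℕ => μ,
      ErrorData.coordSection g n ω =ᵐ[μ] ErrorData.coordSection g' n ω) :
    g =ᵐ[Measure.infinitePi fun _ : ℕ => μ] g' := by
  have hT := measurePreserving_update_infinitePi μ n
  have h1 := Measure.ae_ae_of_ae_prod (hT.quasiMeasurePreserving.ae hg.ae_eq_mk)
  have h2 := Measure.ae_ae_of_ae_prod (hT.quasiMeasurePreserving.ae hg'.ae_eq_mk)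
  have hms : MeasurableSet {ω | hg.mk g ω = hg'.mk g' ω} :=
    measurableSet_eq_fun hg.stronglyMeasurable_mk.measurable hg'.stronglyMeasurable_mk.measurable
  have h3 : ∀ᵐ z ∂(Measure.infinitePi fun _ : ℕ => μ).prod μ,
      hg.mk g (Function.update z.1 n z.2) = hg'.mk g' (Function.update z.1 n z.2) := by
    refine (Measure.ae_prod_iff_ae_ae (hT.measurable hms)).2 ?_
    filter_upwards [h1, h2, h] with ω a1 a2 a3
    filter_upwards [a1, a2, a3] with x b1 b2 b3
    rw [← b1, ← b2]
    exact b3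
  have h4 : hg.mk g =ᵐ[Measure.infinitePi fun _ : ℕ => μ] hg'.mk g' := by
    have := (ae_map_iff hT.measurable.aemeasurable hms).2 h3
    rwa [hT.map_eq] at this
  exact hg.ae_eq_mk.trans (h4.trans hg'.ae_eq_mk.symm)

end Update

theorem IsC1Lip.comp_affine {E F : Type*} [NormedAddCommGroup E] [NormedSpace ℝ E]
    [NormedAddCommGroup F] [NormedSpace ℝ F] {G : F → ℝ} (hG : IsC1Lip G) (L : E →L[ℝ] F) (b : F) :
    IsC1Lip fun x => G (b + L x) := by
  obtain ⟨K, hK⟩ := hG.2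
  refine ⟨hG.1.comp (contDiff_const.add L.contDiff), K * ‖L‖₊, hK.comp ?_⟩
  refine LipschitzWith.of_dist_le_mul fun x y => ?_
  rw [dist_add_left]
  exact L.lipschitz.dist_le_mul x y

/-- The vector of the linear combinations `∑_{k < N} a i k ω k` of the coordinates of `ω`. -/
def linComb {p : ℕ} (a : Fin p → ℕ → ℝ) (N : ℕ) (ω : ℕ → ℝ) (i : Fin p) : ℝ :=
  ∑ k ∈ Finset.range N, a i k * ω k

theorem linComb_update {p : ℕ} {a : Fin p → ℕ → ℝ} {N : ℕ} (ha : ∀ i k, N ≤ k → a i k = 0)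
    (ω : ℕ → ℝ) (n : ℕ) (x : ℝ) (i : Fin p) :
    linComb a N (Function.update ω n x) i = linComb a N ω i + a i n * (x - ω n) := by
  have h : ∀ k, a i k * Function.update ω n x k =
      a i k * ω k + if k = n then a i n * (x - ω n) else 0 := by
    intro k
    by_cases hk : k = n
    · subst hk
      simp
      ring
    · simp [hk]
  simp only [linComb, h, Finset.sum_add_distrib, Finset.sum_ite_eq', Finset.mem_range]
  split_ifs with hn
  · rfl
  · rw [ha i n (not_lt.1 hn)]
    simp

theorem measurable_linComb {p : ℕ} (a : Fin p → ℕ → ℝ) (N : ℕ) : Measurable (linComb a N) :=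
  measurable_pi_lambda _ fun i =>
    Finset.measurable_fun_sum _ fun k _ => by fun_prop

namespace ErrorData

variable {S : ErrorData ℝ} {p N : ℕ} {a : Fin p → ℕ → ℝ} {F : (Fin p → ℝ) → ℝ}

theorem memLp_coordinate (hS : S.IsErrorStructure) (hid : (fun x : ℝ => x) ∈ S.Dom) (k : ℕ) :
    MemLp (fun ω : ℕ → ℝ => ω k) 2 (Measure.infinitePi fun _ : ℕ => S.P) :=
  (hS.memLp _ hid).comp_measurePreserving (measurePreserving_eval_infinitePi (fun _ => S.P) k)

theorem memLp_linComb (hS : S.IsErrorStructure) (hid : (fun x : ℝ => x) ∈ S.Dom)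
    (a : Fin p → ℕ → ℝ) (N : ℕ) :
    MemLp (linComb a N) 2 (Measure.infinitePi fun _ : ℕ => S.P) :=
  MemLp.of_eval fun i => memLp_finsetSum _ fun k _ => (memLp_coordinate hS hid k).const_mul (a i k)

theorem integrable_gamma_coordinate (hS : S.IsErrorStructure) (hid : (fun x : ℝ => x) ∈ S.Dom)
    (k : ℕ) : Integrable (fun ω : ℕ → ℝ => S.Γ (fun x => x) (fun x => x) (ω k))
      (Measure.infinitePi fun _ : ℕ => S.P) :=
  (measurePreserving_eval_infinitePi (fun _ : ℕ => S.P) k).integrable_comp_of_integrable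
    (hS.gamma_integrable _ hid _ hid)

/-- The squared field operator in the `n`-th coordinate of `F(∑ₖ aₖ ωₖ)`, where `aₖ` is the vector
of the `a i k`. -/
def linCombGamma (S : ErrorData ℝ) (a : Fin p → ℕ → ℝ) (N : ℕ) (F : (Fin p → ℝ) → ℝ) (n : ℕ)
    (ω : ℕ → ℝ) : ℝ :=
  (∑ i, a i n * partialDeriv F i (linComb a N ω)) ^ 2 * S.Γ (fun x => x) (fun x => x) (ω n)

theorem integrable_linCombGamma (hS : S.IsErrorStructure) (hid : (fun x : ℝ => x) ∈ S.Dom)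
    (a : Fin p → ℕ → ℝ) (N : ℕ) (hF : IsC1Lip F) (n : ℕ) :
    Integrable (S.linCombGamma a N F n) (Measure.infinitePi fun _ : ℕ => S.P) := by
  obtain ⟨C, hC0, hC⟩ := hF.exists_bound_partialDeriv
  have hm : Measurable fun ω => (∑ i, a i n * partialDeriv F i (linComb a N ω)) ^ 2 :=
    (Finset.measurable_fun_sum _ fun i _ => ((hF.continuous_partialDeriv i).measurable.comp
      (measurable_linComb a N)).const_mul _).pow_const 2
  refine (integrable_gamma_coordinate hS hid n).bdd_mul (c := (∑ i, |a i n| * C) ^ 2)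
    hm.aestronglyMeasurable (ae_of_all _ fun ω => ?_)
  rw [norm_pow, Real.norm_eq_abs]
  refine pow_le_pow_left₀ (abs_nonneg _) ((Finset.abs_sum_le_sum_abs _ _).trans
    (Finset.sum_le_sum fun i _ => ?_)) 2
  rw [abs_mul]
  exact mul_le_mul_of_nonneg_left (hC i _) (abs_nonneg _)

/-- As a function of the `n`-th coordinate alone, `F(∑ₖ aₖ ωₖ)` is a `C¹ ∩ Lip` function of the
identity, so its squared field operator is given by the functional calculus. -/
theorem isPartialGamma_linComb (hS : S.IsErrorStructure) (hid : (fun x : ℝ => x) ∈ S.Dom)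
    (ha : ∀ i k, N ≤ k → a i k = 0) (hF : IsC1Lip F) (n : ℕ) :
    S.IsPartialGamma n (fun ω => F (linComb a N ω)) (fun ω => F (linComb a N ω))
      (S.linCombGamma a N F n) := by
  refine ⟨(integrable_linCombGamma hS hid a N hF n).aestronglyMeasurable, ae_of_all _ fun ω => ?_⟩
  let L : (Fin 1 → ℝ) →L[ℝ] (Fin p → ℝ) :=
    ContinuousLinearMap.pi fun i => a i n • ContinuousLinearMap.proj 0
  let b : Fin p → ℝ := fun i => linComb a N ω i - a i n * ω n
  have hL : ∀ x : ℝ, b + L (fun _ => x) = linComb a N (Function.update ω n x) := by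
    intro x
    ext i
    rw [linComb_update ha]
    simp [b, L]
    ring
  have hG : IsC1Lip fun y => F (b + L y) := hF.comp_affine L b
  have hsec : coordSection (fun ω => F (linComb a N ω)) n ω =
      fun x => F (b + L fun _ => x) := by
    funext x
    rw [coordSection, hL]
  have hpd : ∀ x : ℝ, partialDeriv (fun y => F (b + L y)) 0 (fun _ => x) =
      ∑ i, a i n * partialDeriv F i (linComb a N (Function.update ω n x)) := by
    intro x
    have h1 : HasFDerivAt (fun y => b + L y) L (fun _ : Fin 1 => x) := L.hasFDerivAt.const_add b
    have h2 := (hF.differentiable (b + L fun _ => x)).hasFDerivAt.comp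
      (fun _ : Fin 1 => x) h1
    have h3 : fderiv ℝ (fun y => F (b + L y)) (fun _ => x) =
        (fderiv ℝ F (b + L fun _ => x)).comp L := h2.fderiv
    rw [partialDeriv, h3, ContinuousLinearMap.comp_apply, fderiv_apply_eq_sum_partialDeriv, hL]
    simp [L]
  have hmem := hS.calculus_mem 1 (fun _ x => x) (fun y => F (b + L y)) (fun _ => hid) hG
  have hgam := hS.calculus_gamma 1 1 (fun _ x => x) (fun _ x => x) (fun y => F (b + L y))
    (fun y => F (b + L y)) (fun _ => hid) (fun _ => hid) hG hG
  rw [hsec]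
  refine ⟨hmem, hmem, ?_⟩
  filter_upwards [hgam] with x hx
  rw [hx]
  simp only [Fin.sum_univ_one, coordSection, linCombGamma, hpd, Function.update_self]
  ring

theorem linCombGamma_eq_zero (ha : ∀ i k, N ≤ k → a i k = 0) {n : ℕ} (hn : N ≤ n) :
    S.linCombGamma a N F n = 0 := by
  funext ω
  simp [linCombGamma, ha _ n hn]

theorem linComb_mem_dom_pow (hS : S.IsErrorStructure) (hid : (fun x : ℝ => x) ∈ S.Dom)
    (ha : ∀ i k, N ≤ k → a i k = 0) (hF : IsC1Lip F) :
    (fun ω => F (linComb a N ω)) ∈ S.pow.Dom := by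
  refine ⟨hF.memLp_comp (memLp_linComb hS hid a N), fun n => S.linCombGamma a N F n,
    isPartialGamma_linComb hS hid ha hF, ?_⟩
  have e : ∀ ω, ∑' n, ENNReal.ofReal (S.linCombGamma a N F n ω) =
      ∑ n ∈ Finset.range N, ENNReal.ofReal (S.linCombGamma a N F n ω) := fun ω =>
    tsum_eq_sum fun n hn => by
      rw [linCombGamma_eq_zero ha (by simpa using hn), Pi.zero_apply, ENNReal.ofReal_zero]
  have hint := integrable_linCombGamma hS hid a N hF
  simp_rw [e]
  rw [lintegral_finsetSum' _ fun n _ => (hint n).aemeasurable.ennreal_ofReal]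
  exact ENNReal.sum_lt_top.2 fun n _ => (hint n).lintegral_lt_top

/-- The squared field operator of the product structure involves a choice of versions of the partial
operators; all of them agree almost everywhere with `linCombGamma`. -/
theorem gamma_pow_linComb (hS : S.IsErrorStructure) (hid : (fun x : ℝ => x) ∈ S.Dom)
    (ha : ∀ i k, N ≤ k → a i k = 0) (hF : IsC1Lip F) :
    S.pow.Γ (fun ω => F (linComb a N ω)) (fun ω => F (linComb a N ω)) =ᵐ[S.pow.P]
      fun ω => ∑ n ∈ Finset.range N, S.linCombGamma a N F n ω := by
  have H : ∃ g : ℕ → (ℕ → ℝ) → ℝ, ∀ n, S.IsPartialGamma n (fun ω => F (linComb a N ω))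
      (fun ω => F (linComb a N ω)) (g n) := ⟨_, isPartialGamma_linComb hS hid ha hF⟩
  have e : S.pow.Γ (fun ω => F (linComb a N ω)) (fun ω => F (linComb a N ω)) =
      fun ω => ∑' n, H.choose n ω := dif_pos H
  have heq : ∀ n, H.choose n =ᵐ[S.pow.P] S.linCombGamma a N F n := by
    intro n
    have h1 := H.choose_spec n
    have h2 := isPartialGamma_linComb hS hid ha hF n
    refine ae_eq_of_coordSection_ae_eq h1.aesm h2.aesm (n := n) ?_
    filter_upwards [h1.sections, h2.sections] with ω a1 a2
    exact a1.2.2.trans a2.2.2.symm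
  rw [e]
  filter_upwards [ae_all_iff.2 heq] with ω hω
  simp_rw [hω]
  exact tsum_eq_sum fun n hn => by
    rw [linCombGamma_eq_zero ha (by simpa using hn), Pi.zero_apply]

end ErrorData

/-! ### Coefficients of the random walk -/

/-- The weight of the `k`-th step in the unnormalized interpolated random walk at time `t`. -/
def stepWeight (n : ℕ) (t : unitInterval) (k : ℕ) : ℝ :=
  (if k < ⌊(n : ℝ) * t⌋₊ then 1 else 0) +
    if k = ⌊(n : ℝ) * t⌋₊ then (n : ℝ) * t - ⌊(n : ℝ) * t⌋₊ else 0

/-- The coefficient of the `k`-th step in the interpolated random walk at time `t`. -/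
def walkCoeff (n : ℕ) (t : unitInterval) (k : ℕ) : ℝ :=
  1 / √(n : ℝ) * stepWeight n t k

theorem floor_mul_le (n : ℕ) (t : unitInterval) : ⌊(n : ℝ) * t⌋₊ ≤ n := by
  have h : (n : ℝ) * t ≤ n := mul_le_of_le_one_right (Nat.cast_nonneg n) t.2.2
  exact (Nat.floor_le_floor h).trans (Nat.floor_natCast n).le

theorem fract_mul_nonneg (n : ℕ) (t : unitInterval) :
    0 ≤ (n : ℝ) * t - ⌊(n : ℝ) * t⌋₊ :=
  sub_nonneg.2 (Nat.floor_le (mul_nonneg (Nat.cast_nonneg n) t.2.1))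

theorem fract_mul_le_one (n : ℕ) (t : unitInterval) :
    (n : ℝ) * t - ⌊(n : ℝ) * t⌋₊ ≤ 1 := by
  have := Nat.lt_floor_add_one ((n : ℝ) * t)
  linarith

theorem stepWeight_nonneg (n : ℕ) (t : unitInterval) (k : ℕ) : 0 ≤ stepWeight n t k := by
  have := fract_mul_nonneg n t
  unfold stepWeight
  split_ifs <;> linarith

theorem stepWeight_le_one (n : ℕ) (t : unitInterval) (k : ℕ) : stepWeight n t k ≤ 1 := by
  have := fract_mul_le_one n t
  unfold stepWeight
  split_ifs <;> first | omega | linarith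

theorem walkCoeff_eq_zero {n : ℕ} (t : unitInterval) {k : ℕ} (hk : n + 1 ≤ k) :
    walkCoeff n t k = 0 := by
  have := floor_mul_le n t
  rw [walkCoeff, stepWeight, if_neg (by omega), if_neg (by omega)]
  simp

theorem abs_walkCoeff_le (n : ℕ) (t : unitInterval) (k : ℕ) :
    |walkCoeff n t k| ≤ 1 / √(n : ℝ) := by
  rw [walkCoeff, abs_mul, abs_of_nonneg (by positivity), abs_of_nonneg (stepWeight_nonneg n t k)]
  exact mul_le_of_le_one_right (by positivity) (stepWeight_le_one n t k)

theorem randomWalk_eq_linComb {p : ℕ} (n : ℕ) (t : Fin p → unitInterval) (ω : ℕ → ℝ) :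
    (fun i => randomWalk n (t i) ω) = linComb (fun i => walkCoeff n (t i)) (n + 1) ω := by
  funext i
  have hM := floor_mul_le n (t i)
  have e : (Finset.range (n + 1)).filter (fun k => k < ⌊(n : ℝ) * (t i)⌋₊) =
      Finset.range ⌊(n : ℝ) * (t i)⌋₊ := by
    ext k
    simp only [Finset.mem_filter, Finset.mem_range]
    omega
  simp only [randomWalk, linComb, walkCoeff, stepWeight, mul_assoc, ← Finset.mul_sum, add_mul,
    Finset.sum_add_distrib, ite_mul, one_mul, zero_mul, Finset.sum_ite_eq', Finset.mem_range,
    if_pos (Nat.lt_succ_of_le hM)]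
  rw [← Finset.sum_filter, e]

/-- For times `s ≤ t`, the weights at time `t` are one on the complete steps before time `s`. -/
theorem stepWeight_mul_stepWeight {n : ℕ} {s t : unitInterval} (hst : s ≤ t) (k : ℕ) :
    stepWeight n s k * stepWeight n t k = (if k < ⌊(n : ℝ) * s⌋₊ then 1 else 0) +
      if k = ⌊(n : ℝ) * s⌋₊ then
        ((n : ℝ) * s - ⌊(n : ℝ) * s⌋₊) * stepWeight n t ⌊(n : ℝ) * s⌋₊ else 0 := by
  have hle : ⌊(n : ℝ) * s⌋₊ ≤ ⌊(n : ℝ) * t⌋₊ :=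
    Nat.floor_le_floor (mul_le_mul_of_nonneg_left (Subtype.coe_le_coe.2 hst) (Nat.cast_nonneg n))
  rcases lt_trichotomy k ⌊(n : ℝ) * s⌋₊ with h | h | h
  · have ht : stepWeight n t k = 1 := by
      rw [stepWeight, if_pos (h.trans_le hle), if_neg (h.trans_le hle).ne, add_zero]
    rw [ht]
    simp [stepWeight, h, h.ne]
  · subst h
    simp [stepWeight]
  · simp [stepWeight, h.not_gt, h.ne']

/-- A law of large numbers for arithmetic means passes to the weighted means in which the `k`-th
term has the product of its coefficients in the random walk at times `s` and `t` as its weight. -/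
theorem tendsto_sum_walkCoeff_smul {V : Type*} [NormedAddCommGroup V] [NormedSpace ℝ V]
    {y : ℕ → V} {K : ℝ} {c : V} (hK : ∀ k, ‖y k‖ ≤ K)
    (h : Tendsto (fun M : ℕ => (M : ℝ)⁻¹ • ∑ k ∈ Finset.range M, y k) atTop (𝓝 c))
    (s t : unitInterval) :
    Tendsto (fun n => ∑ k ∈ Finset.range (n + 1), (walkCoeff n s k * walkCoeff n t k) • y k)
      atTop (𝓝 (min (s : ℝ) (t : ℝ) • c)) := by
  wlog hst : s ≤ t generalizing s t
  · have := this t s (le_of_not_ge hst)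
    simpa only [mul_comm (walkCoeff _ t _), min_comm (t : ℝ)] using this
  rw [min_eq_left (Subtype.coe_le_coe.2 hst)]
  have hK0 : 0 ≤ K := (norm_nonneg _).trans (hK 0)
  have e : ∀ n : ℕ, ∑ k ∈ Finset.range (n + 1), (walkCoeff n s k * walkCoeff n t k) • y k =
      ((⌊(s : ℝ) * n⌋₊ : ℝ) / n) • ((⌊(s : ℝ) * n⌋₊ : ℝ)⁻¹ •
        ∑ k ∈ Finset.range ⌊(s : ℝ) * n⌋₊, y k) +
      (n : ℝ)⁻¹ • ((((n : ℝ) * s - ⌊(n : ℝ) * s⌋₊) * stepWeight n t ⌊(n : ℝ) * s⌋₊) •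
        y ⌊(n : ℝ) * s⌋₊) := by
    intro n
    have hM := floor_mul_le n s
    have e1 : (Finset.range (n + 1)).filter (fun k => k < ⌊(n : ℝ) * s⌋₊) =
        Finset.range ⌊(n : ℝ) * s⌋₊ := by
      ext k
      simp only [Finset.mem_filter, Finset.mem_range]
      omega
    have e2 : ∀ k, walkCoeff n s k * walkCoeff n t k =
        (n : ℝ)⁻¹ * (stepWeight n s k * stepWeight n t k) := by
      intro k
      have : (1 / √(n : ℝ)) * (1 / √(n : ℝ)) = (n : ℝ)⁻¹ := by
        rw [div_mul_div_comm, Real.mul_self_sqrt (Nat.cast_nonneg n), one_mul, one_div]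
      rw [walkCoeff, walkCoeff, ← this]
      ring
    simp only [e2, stepWeight_mul_stepWeight hst, mul_smul, ← Finset.smul_sum, add_smul, ite_smul,
      one_smul, zero_smul, Finset.sum_add_distrib, Finset.sum_ite_eq', Finset.mem_range,
      if_pos (Nat.lt_succ_of_le hM), smul_add]
    rw [← Finset.sum_filter, e1, mul_comm (s : ℝ)]
    congr 1
    rw [smul_smul]
    rcases Nat.eq_zero_or_pos ⌊(n : ℝ) * s⌋₊ with h0 | h0
    · simp [h0]
    · congr 1
      have : (⌊(n : ℝ) * s⌋₊ : ℝ) ≠ 0 := by positivity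
      field_simp
  simp_rw [e]
  rw [← add_zero ((s : ℝ) • c)]
  refine Tendsto.add ?_ ?_
  · rcases eq_or_lt_of_le s.2.1 with h0 | h0
    · simp [← h0]
    · have h1 : Tendsto (fun n : ℕ => (⌊(s : ℝ) * n⌋₊ : ℝ) / n) atTop (𝓝 s) :=
        (tendsto_nat_floor_mul_div_atTop h0.le).comp tendsto_natCast_atTop_atTop
      have h2 : Tendsto (fun n : ℕ => ⌊(s : ℝ) * n⌋₊) atTop atTop :=
        tendsto_nat_floor_atTop.comp (tendsto_natCast_atTop_atTop.const_mul_atTop h0)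
      exact h1.smul (h.comp h2)
  · refine squeeze_zero_norm (a := fun n : ℕ => (n : ℝ)⁻¹ * K) (fun n => ?_) ?_
    · rw [norm_smul, norm_inv, Real.norm_of_nonneg (Nat.cast_nonneg n), norm_smul]
      refine mul_le_mul_of_nonneg_left ?_ (by positivity)
      rw [Real.norm_of_nonneg (mul_nonneg (fract_mul_nonneg n s) (stepWeight_nonneg _ _ _))]
      exact (mul_le_of_le_one_left (norm_nonneg _) (mul_le_one₀ (fract_mul_le_one n s)
        (stepWeight_nonneg _ _ _) (stepWeight_le_one _ _ _))).trans (hK _)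
    · have h0 : Tendsto (fun n : ℕ => (n : ℝ)⁻¹) atTop (𝓝 0) := tendsto_inv_atTop_nhds_zero_nat
      simpa using h0.mul_const K

theorem tendsto_sum_walkCoeff_mul (s t : unitInterval) :
    Tendsto (fun n => ∑ k ∈ Finset.range (n + 1), walkCoeff n s k * walkCoeff n t k)
      atTop (𝓝 (min (s : ℝ) (t : ℝ))) := by
  have h : Tendsto (fun M : ℕ => (M : ℝ)⁻¹ • ∑ k ∈ Finset.range M, (1 : ℝ)) atTop (𝓝 1) := by
    refine tendsto_const_nhds.congr' ?_
    filter_upwards [eventually_ne_atTop 0] with M hM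
    simp [hM]
  simpa using tendsto_sum_walkCoeff_smul (y := fun _ => (1 : ℝ)) (K := 1) (by simp) h s t

/-! ### Characteristic functions of triangular arrays -/

theorem charFun_sub_isLittleO {μ : Measure ℝ} [IsProbabilityMeasure μ] (hμ : MemLp id 2 μ)
    (h0 : ∫ x, x ∂μ = 0) :
    (fun t : ℝ => charFun μ t - (1 - ((∫ x, x ^ 2 ∂μ : ℝ) : ℂ) * t ^ 2 / 2)) =o[𝓝 0]
      fun t => t ^ 2 := by
  have h := taylor_isLittleO_univ (f := charFun μ) (x₀ := 0) (n := 2) (contDiff_charFun hμ)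
  have e : ∀ t, taylorWithinEval (charFun μ) 2 Set.univ 0 t =
      1 - ((∫ x, x ^ 2 ∂μ : ℝ) : ℂ) * t ^ 2 / 2 := by
    intro t
    have := taylorWithinEval_charFun_two_zero (P := μ) (X := id) aemeasurable_id
      (by rwa [Measure.map_id]) t
    rw [Measure.map_id] at this
    rw [this]
    simp [h0]
  simp only [e, sub_zero] at h
  exact h

/-- Two centered laws with the same variance have characteristic functions which agree up to
second order at the origin. -/
theorem charFun_sub_charFun_isLittleO {μ ν : Measure ℝ} [IsProbabilityMeasure μ]
    [IsProbabilityMeasure ν] (hμ : MemLp id 2 μ) (hν : MemLp id 2 ν)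
    (h0 : ∫ x, x ∂μ = 0) (h0' : ∫ x, x ∂ν = 0) (h2 : ∫ x, x ^ 2 ∂μ = ∫ x, x ^ 2 ∂ν) :
    (fun t : ℝ => charFun μ t - charFun ν t) =o[𝓝 0] fun t => t ^ 2 := by
  have h := (charFun_sub_isLittleO hμ h0).sub (charFun_sub_isLittleO hν h0')
  rw [h2] at h
  simpa using h

theorem norm_prod_sub_prod_le {ι : Type*} (s : Finset ι) (f g : ι → ℂ) (hf : ∀ i, ‖f i‖ ≤ 1)
    (hg : ∀ i, ‖g i‖ ≤ 1) : ‖∏ i ∈ s, f i - ∏ i ∈ s, g i‖ ≤ ∑ i ∈ s, ‖f i - g i‖ := by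
  classical
  induction s using Finset.induction with
  | empty => simp
  | insert i s hi ih =>
    rw [Finset.prod_insert hi, Finset.prod_insert hi, Finset.sum_insert hi]
    have e : f i * ∏ j ∈ s, f j - g i * ∏ j ∈ s, g j =
        (f i - g i) * ∏ j ∈ s, f j + g i * (∏ j ∈ s, f j - ∏ j ∈ s, g j) := by ring
    have hp : ‖∏ j ∈ s, f j‖ ≤ 1 := by
      rw [norm_prod]
      exact Finset.prod_le_one (fun _ _ => norm_nonneg _) fun j _ => hf j
    rw [e]
    refine (norm_add_le _ _).trans (add_le_add ?_ ?_)
    · rw [norm_mul]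
      exact mul_le_of_le_one_right (norm_nonneg _) hp
    · rw [norm_mul]
      exact (mul_le_of_le_one_left (norm_nonneg _) (hg i)).trans ih

/-- Lindeberg's replacement argument: for a triangular array of coefficients `b n k` which is
uniformly small and has convergent sums of squares, a centered square integrable law may be
replaced by the Gaussian law of the same variance. -/
theorem tendsto_prod_charFun {μ : Measure ℝ} [IsProbabilityMeasure μ] (hμ : MemLp id 2 μ)
    (h0 : ∫ x, x ∂μ = 0) {b : ℕ → ℕ → ℝ} {N : ℕ → ℕ} {Q : ℝ} {r : ℕ → ℝ}
    (hr : Tendsto r atTop (𝓝 0)) (hb : ∀ n k, |b n k| ≤ r n)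
    (hQ : Tendsto (fun n => ∑ k ∈ Finset.range (N n), b n k ^ 2) atTop (𝓝 Q)) :
    Tendsto (fun n => ∏ k ∈ Finset.range (N n), charFun μ (b n k)) atTop
      (𝓝 (Complex.exp (-((∫ x, x ^ 2 ∂μ) * Q / 2 : ℝ)))) := by
  have hs0 : 0 ≤ ∫ x, x ^ 2 ∂μ := integral_nonneg fun x => sq_nonneg x
  let σ : NNReal := ⟨∫ x, x ^ 2 ∂μ, hs0⟩
  have hν : MemLp id 2 (gaussianReal 0 σ) := memLp_id_gaussianReal' 2 (by simp)
  have hν2 : ∫ x, x ^ 2 ∂gaussianReal 0 σ = σ := by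
    have := variance_of_integral_eq_zero (X := id) (μ := gaussianReal 0 σ) aemeasurable_id
      (by simp)
    rw [variance_id_gaussianReal] at this
    exact this.symm
  have hlo := charFun_sub_charFun_isLittleO hμ hν h0 integral_id_gaussianReal hν2.symm
  have hG : Tendsto (fun n => ∏ k ∈ Finset.range (N n), charFun (gaussianReal 0 σ) (b n k)) atTop
      (𝓝 (Complex.exp (-((∫ x, x ^ 2 ∂μ) * Q / 2 : ℝ)))) := by
    have e : ∀ n, ∏ k ∈ Finset.range (N n), charFun (gaussianReal 0 σ) (b n k) =
        Complex.exp (-((∫ x, x ^ 2 ∂μ) * (∑ k ∈ Finset.range (N n), b n k ^ 2) / 2 : ℝ)) := by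
      intro n
      simp_rw [charFun_gaussianReal]
      rw [← Complex.exp_sum]
      congr 1
      push_cast
      rw [Finset.mul_sum, Finset.sum_div, ← Finset.sum_neg_distrib]
      refine Finset.sum_congr rfl fun k _ => ?_
      have : ((σ : ℝ) : ℂ) = ((∫ x, x ^ 2 ∂μ : ℝ) : ℂ) := rfl
      rw [this]
      ring
    simp_rw [e]
    refine (Complex.continuous_exp.tendsto _).comp (Tendsto.neg ?_)
    exact (Complex.continuous_ofReal.tendsto _).comp ((hQ.const_mul _).div_const 2)
  have hd : Tendsto (fun n => ∏ k ∈ Finset.range (N n), charFun μ (b n k) -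
      ∏ k ∈ Finset.range (N n), charFun (gaussianReal 0 σ) (b n k)) atTop (𝓝 0) := by
    rw [Metric.tendsto_nhds]
    intro ε hε
    have hQ0 : 0 ≤ Q := ge_of_tendsto' hQ fun n => Finset.sum_nonneg fun k _ => sq_nonneg _
    have hη : 0 < ε / (Q + 1) := by positivity
    obtain ⟨δ, hδ, hball⟩ := Metric.eventually_nhds_iff.1 (hlo.def hη)
    filter_upwards [hr.eventually (gt_mem_nhds hδ),
      hQ.eventually (gt_mem_nhds (lt_add_one Q))] with n hn1 hn2
    rw [dist_zero_right]
    refine (norm_prod_sub_prod_le _ _ _ (fun k => norm_charFun_le_one _)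
      (fun k => norm_charFun_le_one _)).trans_lt ?_
    have h1 : ∀ k, ‖charFun μ (b n k) - charFun (gaussianReal 0 σ) (b n k)‖ ≤
        ε / (Q + 1) * b n k ^ 2 := by
      intro k
      have := hball (y := b n k) (by
        rw [Real.dist_eq, sub_zero]
        exact (hb n k).trans_lt hn1)
      simpa using this
    refine (Finset.sum_le_sum fun k _ => h1 k).trans_lt ?_
    rw [← Finset.mul_sum]
    calc ε / (Q + 1) * ∑ k ∈ Finset.range (N n), b n k ^ 2 < ε / (Q + 1) * (Q + 1) :=
          mul_lt_mul_of_pos_left hn2 hη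
      _ = ε := by field_simp
  simpa using hd.add hG

/-! ### Weak convergence of the random walk -/

theorem charFun_map_toLp {p : ℕ} {Ω : Type*} [MeasurableSpace Ω] (P : Measure Ω)
    {X : Ω → Fin p → ℝ} (hX : Measurable X) (ξ : EuclideanSpace ℝ (Fin p)) :
    charFun (P.map fun ω => WithLp.toLp 2 (X ω)) ξ =
      charFun (P.map fun ω => ∑ i, ξ i * X ω i) 1 := by
  have hX' : ∀ i, Measurable fun ω => X ω i := fun i => (measurable_pi_apply i).comp hX
  have h1 : Measurable fun ω => WithLp.toLp 2 (X ω) := (WithLp.measurable_toLp 2 _).comp hX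
  have h2 : Measurable fun ω => ∑ i, ξ i * X ω i :=
    Finset.measurable_fun_sum _ fun i _ => (hX' i).const_mul _
  rw [charFun_apply, charFun_apply, integral_map h1.aemeasurable (by fun_prop),
    integral_map h2.aemeasurable (by fun_prop)]
  refine integral_congr_ae (ae_of_all _ fun ω => ?_)
  simp [PiLp.inner_apply, mul_comm]

/-- Lévy's continuity theorem combined with the Cramér-Wold device. -/
theorem tendsto_integral_of_tendsto_charFun_sum {p : ℕ} {Ω Ω' : Type*} [MeasurableSpace Ω]
    [MeasurableSpace Ω'] {P : Measure Ω} {Q : Measure Ω'} [IsProbabilityMeasure P]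
    [IsProbabilityMeasure Q] {X : ℕ → Ω → Fin p → ℝ} {Y : Ω' → Fin p → ℝ}
    (hX : ∀ n, Measurable (X n)) (hY : Measurable Y)
    (h : ∀ ξ : Fin p → ℝ,
      Tendsto (fun n => charFun (P.map fun ω => ∑ i, ξ i * X n ω i) 1) atTop
        (𝓝 (charFun (Q.map fun ω => ∑ i, ξ i * Y ω i) 1)))
    (f : BoundedContinuousFunction (Fin p → ℝ) ℝ) :
    Tendsto (fun n => ∫ ω, f (X n ω) ∂P) atTop (𝓝 (∫ ω, f (Y ω) ∂Q)) := by
  have hE : TendstoInDistribution (fun n ω => WithLp.toLp 2 (X n ω)) atTop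
      (fun ω => WithLp.toLp 2 (Y ω)) (fun _ => P) Q :=
    { forall_aemeasurable := fun n => ((WithLp.measurable_toLp 2 _).comp (hX n)).aemeasurable
      aemeasurable_limit := ((WithLp.measurable_toLp 2 _).comp hY).aemeasurable
      tendsto := by
        refine ProbabilityMeasure.tendsto_iff_tendsto_charFun.2 fun ξ => ?_
        simp only [ProbabilityMeasure.coe_mk, charFun_map_toLp _ (hX _), charFun_map_toLp _ hY]
        exact h fun i => ξ i }
  have hE' := hE.continuous_comp (g := fun x : EuclideanSpace ℝ (Fin p) => x.ofLp) (by fun_prop)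
  have := (ProbabilityMeasure.tendsto_iff_forall_integral_tendsto.1 hE'.tendsto) f
  simp only [ProbabilityMeasure.coe_mk] at this
  convert this using 2
  · exact (integral_map (hX _).aemeasurable f.continuous.aestronglyMeasurable).symm
  · exact (integral_map hY.aemeasurable f.continuous.aestronglyMeasurable).symm

theorem WienerSpace.IsWienerMeasure.charFun_sum {v : ℝ} {m : Measure Path}
    (hW : IsWienerMeasure v m) {p : ℕ} (t : Fin p → unitInterval) (ξ : Fin p → ℝ) :
    charFun (m.map fun w => ∑ i, ξ i * w (t i)) 1 =
      Complex.exp (-(v * (∑ i, ∑ j, ξ i * ξ j * min (t i : ℝ) (t j : ℝ)) / 2 : ℝ)) := by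
  have hm := hW.isGaussian.isProbabilityMeasure
  have hG : HasGaussianLaw (fun w : Path => ∑ i, ξ i * w (t i)) m := by
    have := ((hW.isGaussian.comp_right t).comp_left
      fun i => ξ i • ContinuousLinearMap.id ℝ ℝ).hasGaussianLaw_fun_sum (I := Finset.univ)
    simpa using this
  have h2 : ∀ i, MemLp (fun w : Path => ξ i * w (t i)) 2 m := fun i =>
    (hW.memLp_coord (t i) (p := 2) (by simp)).const_mul _
  have hmean : ∫ w : Path, ∑ i, ξ i * w (t i) ∂m = 0 := by
    rw [integral_finsetSum _ fun i _ => (h2 i).integrable (by simp)]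
    simp [integral_const_mul, hW.mean]
  have hvar : Var[fun w : Path => ∑ i, ξ i * w (t i); m] =
      v * (∑ i, ∑ j, ξ i * ξ j * min (t i : ℝ) (t j : ℝ)) := by
    rw [← covariance_self hG.aemeasurable, covariance_fun_sum_fun_sum h2 h2, Finset.mul_sum]
    refine Finset.sum_congr rfl fun i _ => ?_
    rw [Finset.mul_sum]
    refine Finset.sum_congr rfl fun j _ => ?_
    rw [covariance_const_mul_left, covariance_const_mul_right, hW.cov]
    ring
  rw [hG.charFun_map_eq]
  have e : ∀ x : ℝ, inner ℝ 1 x = x := fun x => by simp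
  simp only [e]
  rw [hmean, hvar]
  simp

/-! ### Convergence of the energies -/

/-- The distance in `L¹` of a linear combination of integrable functions to a constant. -/
theorem norm_sum_smul_toL1_sub_const {Ω : Type*} [MeasurableSpace Ω] {P : Measure Ω}
    [IsProbabilityMeasure P] {f : ℕ → Ω → ℝ} (hf : ∀ k, Integrable (f k) P) (s : Finset ℕ)
    (b : ℕ → ℝ) (c : ℝ) :
    ‖∑ k ∈ s, b k • (hf k).toL1 (f k) - (integrable_const c).toL1 (fun _ : Ω => c)‖ =
      ∫ ω, |∑ k ∈ s, b k * f k ω - c| ∂P := by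
  have hsum : (∑ k ∈ s, b k • (hf k).toL1 (f k) : Lp ℝ 1 P) =ᵐ[P]
      fun ω => ∑ k ∈ s, b k * f k ω := by
    induction s using Finset.induction with
    | empty =>
      simp only [Finset.sum_empty]
      exact Lp.coeFn_zero ℝ 1 P
    | insert k s hk ih =>
      simp only [Finset.sum_insert hk]
      filter_upwards [ih, Lp.coeFn_add (b k • (hf k).toL1 (f k)) (∑ k ∈ s, b k • (hf k).toL1 (f k)),
        Lp.coeFn_smul (b k) ((hf k).toL1 (f k)), (hf k).coeFn_toL1] with ω h1 h2 h3 h4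
      rw [h2, Pi.add_apply, h1, h3, Pi.smul_apply, h4, smul_eq_mul]
  rw [L1.norm_eq_integral_norm]
  refine integral_congr_ae ?_
  filter_upwards [hsum, (integrable_const (μ := P) c).coeFn_toL1,
    Lp.coeFn_sub (∑ k ∈ s, b k • (hf k).toL1 (f k)) ((integrable_const c).toL1 (fun _ : Ω => c))]
    with ω h1 h2 h3
  rw [h3, Pi.sub_apply, h1, h2, Real.norm_eq_abs]

/-- If the factors `G n` converge to the constant `K` in `L¹` and the bounded factors `h n` have
convergent integrals, then the integrals of the products converge. -/
theorem tendsto_integral_mul_of_tendsto_integral_abs {Ω : Type*} [MeasurableSpace Ω]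
    {P : Measure Ω} [IsProbabilityMeasure P] {h G : ℕ → Ω → ℝ} {C K L : ℝ}
    (hm : ∀ n, Measurable (h n)) (hC : ∀ n ω, |h n ω| ≤ C) (hG : ∀ n, Integrable (G n) P)
    (hGK : Tendsto (fun n => ∫ ω, |G n ω - K| ∂P) atTop (𝓝 0))
    (hL : Tendsto (fun n => ∫ ω, h n ω ∂P) atTop (𝓝 L)) :
    Tendsto (fun n => ∫ ω, h n ω * G n ω ∂P) atTop (𝓝 (L * K)) := by
  have hi : ∀ n, Integrable (fun ω => h n ω * (G n ω - K)) P := fun n =>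
    ((hG n).sub (integrable_const K)).bdd_mul (hm n).aestronglyMeasurable (ae_of_all _ (hC n))
  have hi' : ∀ n, Integrable (h n) P := fun n =>
    (integrable_const C).mono' (hm n).aestronglyMeasurable (ae_of_all _ (hC n))
  have e : ∀ n, ∫ ω, h n ω * G n ω ∂P =
      ∫ ω, h n ω * (G n ω - K) ∂P + (∫ ω, h n ω ∂P) * K := by
    intro n
    rw [← integral_mul_const, ← integral_add (hi n) ((hi' n).mul_const K)]
    exact integral_congr_ae (ae_of_all _ fun ω => by ring)
  simp_rw [e]
  rw [← zero_add (L * K)]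
  refine Tendsto.add (squeeze_zero_norm (fun n => ?_) (by simpa using hGK.const_mul C))
    (hL.mul_const K)
  rw [← integral_const_mul]
  refine norm_integral_le_of_norm_le (((hG n).sub (integrable_const K)).abs.const_mul C)
    (ae_of_all _ fun ω => ?_)
  rw [norm_mul]
  exact mul_le_mul_of_nonneg_right (hC n ω) (abs_nonneg _)

namespace ErrorData

variable {S : ErrorData ℝ}

theorem charFun_sum_linComb (S : ErrorData ℝ) {p : ℕ} (a : Fin p → ℕ → ℝ) (N : ℕ)
    (ξ : Fin p → ℝ) :
    charFun (S.pow.P.map fun ω => ∑ i, ξ i * linComb a N ω i) 1 =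
      ∏ k ∈ Finset.range N, charFun S.P (∑ i, ξ i * a i k) := by
  have e : (fun ω : ℕ → ℝ => ∑ i, ξ i * linComb a N ω i) =
      fun ω => ∑ k ∈ Finset.range N, (∑ i, ξ i * a i k) * ω k := by
    funext ω
    simp only [linComb, Finset.mul_sum, Finset.sum_mul]
    rw [Finset.sum_comm]
    simp only [mul_assoc]
  have hind : iIndepFun (fun k (ω : ℕ → ℝ) => (∑ i, ξ i * a i k) * ω k) S.pow.P :=
    iIndepFun_infinitePi (P := fun _ : ℕ => S.P) (X := fun k x => (∑ i, ξ i * a i k) * x)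
      fun k => by fun_prop
  rw [e, (hind.restrict _).charFun_map_fun_finsetSum_eq_prod fun k _ =>
    ((measurable_pi_apply k).const_mul _).aemeasurable, Finset.prod_apply]
  refine Finset.prod_congr rfl fun k _ => ?_
  rw [charFun_map_mul_comp (measurable_pi_apply k).aemeasurable, mul_one]
  congr 1
  exact Measure.infinitePi_map_eval (fun _ : ℕ => S.P) k

/-- Donsker's theorem for finite-dimensional marginals. -/
theorem tendsto_integral_randomWalk (hS : S.IsErrorStructure) (hid : (fun x : ℝ => x) ∈ S.Dom)
    (hmean : ∫ x, x ∂S.P = 0) {m : Measure WienerSpace.Path} (hm : IsProbabilityMeasure m)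
    (hW : WienerSpace.IsWienerMeasure (∫ x, x ^ 2 ∂S.P) m) {p : ℕ} (t : Fin p → unitInterval)
    (f : BoundedContinuousFunction (Fin p → ℝ) ℝ) :
    Tendsto (fun n => ∫ ω, f (linComb (fun i => walkCoeff n (t i)) (n + 1) ω) ∂S.pow.P) atTop
      (𝓝 (∫ w, f (fun i => w (t i)) ∂m)) := by
  refine tendsto_integral_of_tendsto_charFun_sum (fun n => measurable_linComb _ _)
    (continuous_pi fun i => ContinuousEvalConst.continuous_eval_const (t i)).measurable
    (fun ξ => ?_) f
  simp only [charFun_sum_linComb]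
  rw [hW.charFun_sum]
  refine tendsto_prod_charFun (hS.memLp _ hid) hmean
    (r := fun n => (∑ i, |ξ i|) * (1 / √(n : ℝ))) ?_ (fun n k => ?_) ?_
  · have : Tendsto (fun n : ℕ => 1 / √(n : ℝ)) atTop (𝓝 0) :=
      tendsto_const_nhds.div_atTop (Real.tendsto_sqrt_atTop.comp tendsto_natCast_atTop_atTop)
    simpa using this.const_mul (∑ i, |ξ i|)
  · refine (Finset.abs_sum_le_sum_abs _ _).trans ?_
    rw [Finset.sum_mul]
    refine Finset.sum_le_sum fun i _ => ?_
    rw [abs_mul]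
    exact mul_le_mul_of_nonneg_left (abs_walkCoeff_le _ _ _) (abs_nonneg _)
  · have e : ∀ n, ∑ k ∈ Finset.range (n + 1), (∑ i, ξ i * walkCoeff n (t i) k) ^ 2 =
        ∑ i, ∑ j, ξ i * ξ j *
          ∑ k ∈ Finset.range (n + 1), walkCoeff n (t i) k * walkCoeff n (t j) k := by
      intro n
      simp_rw [sq, Finset.sum_mul_sum, Finset.mul_sum]
      rw [Finset.sum_comm]
      refine Finset.sum_congr rfl fun i _ => ?_
      rw [Finset.sum_comm]
      exact Finset.sum_congr rfl fun j _ => Finset.sum_congr rfl fun k _ => by ring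
    simp_rw [e]
    exact tendsto_finsetSum _ fun i _ => tendsto_finsetSum _ fun j _ =>
      (tendsto_sum_walkCoeff_mul (t i) (t j)).const_mul _

/-- The law of large numbers in `L¹` for the weighted sums of the `γ[j] (ω k)`. -/
theorem tendsto_integral_abs_sum_gamma (hS : S.IsErrorStructure)
    (hid : (fun x : ℝ => x) ∈ S.Dom) (s t : unitInterval) :
    Tendsto (fun n => ∫ ω, |∑ k ∈ Finset.range (n + 1), walkCoeff n s k * walkCoeff n t k *
        S.Γ (fun x => x) (fun x => x) (ω k) -
        min (s : ℝ) (t : ℝ) * ∫ x, S.Γ (fun x : ℝ => x) (fun x => x) x ∂S.P| ∂S.pow.P)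
      atTop (𝓝 0) := by
  set γ : ℝ → ℝ := S.Γ (fun x => x) (fun x => x) with hγ
  let P := Measure.infinitePi fun _ : ℕ => S.P
  have hint : ∀ k, Integrable (fun ω : ℕ → ℝ => γ (ω k)) P := integrable_gamma_coordinate hS hid
  have hmp : ∀ k, MeasurePreserving (fun ω : ℕ → ℝ => ω k) P S.P := fun k =>
    measurePreserving_eval_infinitePi (fun _ : ℕ => S.P) k
  have hγm : ∀ k, AEMeasurable γ (P.map fun ω : ℕ → ℝ => ω k) := fun k => by
    rw [(hmp k).map_eq]
    exact (hS.gamma_integrable _ hid _ hid).aestronglyMeasurable.aemeasurable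
  have hind : iIndepFun (fun k (ω : ℕ → ℝ) => ω k) P :=
    iIndepFun_infinitePi (P := fun _ : ℕ => S.P) (X := fun _ x => x) fun _ => measurable_id
  have hmean : ∀ k, ∫ ω, γ (ω k) ∂P = ∫ x, γ x ∂S.P := fun k => by
    rw [← integral_map (hmp k).measurable.aemeasurable (hγm k).aestronglyMeasurable,
      (hmp k).map_eq]
  have hLp := strong_law_Lp (μ := P) (p := 1) le_rfl (by simp) (fun k ω => γ (ω k))
    (memLp_one_iff_integrable.2 (hint 0))
    (fun i j hij => (hind.indepFun hij).comp₀ (hmp i).measurable.aemeasurable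
      (hmp j).measurable.aemeasurable (hγm i) (hγm j))
    (fun k => (IdentDistrib.mk (hmp k).measurable.aemeasurable (hmp 0).measurable.aemeasurable
      (by rw [(hmp k).map_eq, (hmp 0).map_eq])).comp_of_aemeasurable (hγm k))
  rw [hmean 0] at hLp
  set c := ∫ x, γ x ∂S.P with hc
  -- Regarded in the Banach space `L¹`, the terms `γ(ω k)` all have the same norm, and their
  -- arithmetic means converge, so that the result on weighted means applies.
  have hlim : Tendsto (fun M : ℕ => (M : ℝ)⁻¹ • ∑ k ∈ Finset.range M, (hint k).toL1 _) atTop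
      (𝓝 ((integrable_const c).toL1 fun _ => c)) := by
    rw [tendsto_iff_norm_sub_tendsto_zero]
    simp_rw [Finset.smul_sum, norm_sum_smul_toL1_sub_const hint]
    refine ((ENNReal.tendsto_toReal ENNReal.zero_ne_top).comp hLp).congr fun M => ?_
    have hi : Integrable (fun ω : ℕ → ℝ => (M : ℝ)⁻¹ • (∑ k ∈ Finset.range M, γ (ω k)) - c) P :=
      ((integrable_finsetSum _ fun k _ => hint k).smul (M : ℝ)⁻¹).sub (integrable_const c)
    rw [Function.comp_apply, eLpNorm_one_eq_lintegral_enorm]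
    refine (integral_norm_eq_lintegral_enorm hi.aestronglyMeasurable).symm.trans ?_
    simp only [smul_eq_mul, Finset.mul_sum, Real.norm_eq_abs]
  have h := tendsto_sum_walkCoeff_smul (K := ∫ x, |γ x| ∂S.P) (fun k => ?_) hlim s t
  · rw [tendsto_iff_norm_sub_tendsto_zero] at h
    refine h.congr fun n => ?_
    have : min (s : ℝ) t • (integrable_const c).toL1 (fun _ : ℕ → ℝ => c) =
      (integrable_const (μ := P) (min (s : ℝ) t * c)).toL1 fun _ => min (s : ℝ) t * c := rfl
    rw [this, norm_sum_smul_toL1_sub_const hint]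
    rfl
  · rw [L1.norm_of_fun_eq_integral_norm]
    have := (hmp k).map_eq ▸ integral_map (hmp k).measurable.aemeasurable
      (hγm k).norm.aestronglyMeasurable
    exact this.ge

theorem sum_linCombGamma (S : ErrorData ℝ) {p : ℕ} (a : Fin p → ℕ → ℝ) (N : ℕ)
    (F : (Fin p → ℝ) → ℝ) (ω : ℕ → ℝ) :
    ∑ n ∈ Finset.range N, S.linCombGamma a N F n ω =
      ∑ i, ∑ j, partialDeriv F i (linComb a N ω) * partialDeriv F j (linComb a N ω) *
        ∑ n ∈ Finset.range N, a i n * a j n * S.Γ (fun x => x) (fun x => x) (ω n) := by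
  simp_rw [linCombGamma, sq, Finset.sum_mul_sum, Finset.sum_mul, Finset.mul_sum]
  rw [Finset.sum_comm]
  refine Finset.sum_congr rfl fun i _ => ?_
  rw [Finset.sum_comm]
  refine Finset.sum_congr rfl fun j _ => Finset.sum_congr rfl fun k _ => ?_
  ring

/-- Convergence of the energies of `F (X_n)`: the law of large numbers replaces the sums of the
`γ[j] (ω k)` by their means, and the weak convergence of `X_n` takes care of the derivatives. -/
theorem tendsto_integral_gamma_randomWalk (hS : S.IsErrorStructure)
    (hid : (fun x : ℝ => x) ∈ S.Dom) (hmean : ∫ x, x ∂S.P = 0)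
    {m : Measure WienerSpace.Path} (hm : IsProbabilityMeasure m)
    (hW : WienerSpace.IsWienerMeasure (∫ x, x ^ 2 ∂S.P) m) {p : ℕ} (t : Fin p → unitInterval)
    {F : (Fin p → ℝ) → ℝ} (hF : IsC1Lip F) :
    Tendsto (fun n => ∫ ω, S.pow.Γ (fun ω => F (linComb (fun i => walkCoeff n (t i)) (n + 1) ω))
        (fun ω => F (linComb (fun i => walkCoeff n (t i)) (n + 1) ω)) ω ∂S.pow.P) atTop
      (𝓝 (∫ w, ∑ i, ∑ j, partialDeriv F i (fun k => w (t k)) *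
        partialDeriv F j (fun k => w (t k)) *
          ((∫ x, S.Γ (fun x : ℝ => x) (fun x => x) x ∂S.P) * min (t i : ℝ) (t j : ℝ)) ∂m)) := by
  obtain ⟨C, hC0, hC⟩ := hF.exists_bound_partialDeriv
  set c := ∫ x, S.Γ (fun x : ℝ => x) (fun x => x) x ∂S.P
  have hCC : ∀ i j x, |partialDeriv F i x * partialDeriv F j x| ≤ C * C := fun i j x => by
    rw [abs_mul]
    exact mul_le_mul (hC i x) (hC j x) (abs_nonneg _) hC0
  have hcont : ∀ i j, Continuous fun x => partialDeriv F i x * partialDeriv F j x := fun i j =>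
    (hF.continuous_partialDeriv i).mul (hF.continuous_partialDeriv j)
  have hB : Continuous fun (w : WienerSpace.Path) (k : Fin p) => w (t k) :=
    continuous_pi fun i => ContinuousEvalConst.continuous_eval_const (t i)
  have hG : ∀ n i j, Integrable (fun ω : ℕ → ℝ => ∑ k ∈ Finset.range (n + 1),
      walkCoeff n (t i) k * walkCoeff n (t j) k * S.Γ (fun x => x) (fun x => x) (ω k))
      S.pow.P := fun n i j =>
    integrable_finsetSum _ fun k _ => (integrable_gamma_coordinate hS hid k).const_mul _
  have hmeas : ∀ n i j, Measurable fun ω : ℕ → ℝ =>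
      partialDeriv F i (linComb (fun i => walkCoeff n (t i)) (n + 1) ω) *
        partialDeriv F j (linComb (fun i => walkCoeff n (t i)) (n + 1) ω) := fun n i j =>
    (hcont i j).measurable.comp (measurable_linComb _ _)
  have e : ∀ n, ∫ ω, S.pow.Γ (fun ω => F (linComb (fun i => walkCoeff n (t i)) (n + 1) ω))
      (fun ω => F (linComb (fun i => walkCoeff n (t i)) (n + 1) ω)) ω ∂S.pow.P =
      ∑ i, ∑ j, ∫ ω, partialDeriv F i (linComb (fun i => walkCoeff n (t i)) (n + 1) ω) *
        partialDeriv F j (linComb (fun i => walkCoeff n (t i)) (n + 1) ω) *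
        ∑ k ∈ Finset.range (n + 1), walkCoeff n (t i) k * walkCoeff n (t j) k *
          S.Γ (fun x => x) (fun x => x) (ω k) ∂S.pow.P := by
    intro n
    have hi := fun i j => (hG n i j).bdd_mul (c := C * C) (hmeas n i j).aestronglyMeasurable
      (ae_of_all _ fun ω => hCC i j _)
    rw [integral_congr_ae (gamma_pow_linComb hS hid (fun i k hk => walkCoeff_eq_zero (t i) hk) hF)]
    simp_rw [sum_linCombGamma]
    rw [integral_finsetSum _ fun i _ => integrable_finsetSum _ fun j _ => hi i j]
    exact Finset.sum_congr rfl fun i _ => integral_finsetSum _ fun j _ => hi i j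
  have hint : ∀ i j, Integrable (fun w : WienerSpace.Path => partialDeriv F i (fun k => w (t k)) *
      partialDeriv F j (fun k => w (t k)) * (c * min (t i : ℝ) (t j : ℝ))) m := fun i j =>
    ((integrable_const (C * C)).mono' ((hcont i j).comp hB).aestronglyMeasurable
      (ae_of_all _ fun w => hCC i j _)).mul_const _
  simp_rw [e]
  rw [integral_finsetSum _ fun i _ => integrable_finsetSum _ fun j _ => hint i j]
  refine tendsto_finsetSum _ fun i _ => ?_
  rw [integral_finsetSum _ fun j _ => hint i j]
  refine tendsto_finsetSum _ fun j _ => ?_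
  rw [integral_mul_const, mul_comm c]
  exact tendsto_integral_mul_of_tendsto_integral_abs (fun n => hmeas n i j)
    (fun n ω => hCC i j _) (fun n => hG n i j) (tendsto_integral_abs_sum_gamma hS hid (t i) (t j))
    (tendsto_integral_randomWalk hS hid hmean hm hW t
      (BoundedContinuousFunction.ofNormedAddCommGroup _ (hcont i j) (C * C) (hCC i j)))

/-- If the identity vanishes almost everywhere, then so does its squared field operator. -/
theorem integral_gamma_id_eq_zero (hS : S.IsErrorStructure) (hid : (fun x : ℝ => x) ∈ S.Dom)
    (h : ∫ x, x ^ 2 ∂S.P = 0) : ∫ x, S.Γ (fun x : ℝ => x) (fun x => x) x ∂S.P = 0 := by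
  have h0 : (fun x : ℝ => x) =ᵐ[S.P] (0 : ℝ) • fun x : ℝ => x := by
    have := (integral_eq_zero_iff_of_nonneg (fun x : ℝ => sq_nonneg x)
      (hS.memLp _ hid).integrable_sq).1 h
    filter_upwards [this] with x hx
    simpa using hx
  rw [integral_congr_ae ((hS.gamma_congr _ hid _ (hS.dom_smul 0 _ hid) _ hid h0).trans
    (hS.gamma_smul 0 _ hid _ hid))]
  simp

end ErrorData

theorem proposition1
    (S : ErrorData ℝ) (hS : S.IsErrorStructure)
    (hid : (fun x : ℝ => x) ∈ S.Dom) (hmean : ∫ x, x ∂S.P = 0)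
    (c : ℝ) (hc : c = ∫ x, S.Γ (fun x : ℝ => x) (fun x : ℝ => x) x ∂S.P)
    (m : Measure WienerSpace.Path) (hm : IsProbabilityMeasure m)
    (hW : WienerSpace.IsWienerMeasure (∫ x, x ^ 2 ∂S.P) m)
    (p : ℕ) (t : Fin p → unitInterval) :
    ErrorData.ConvergesInDirichletLaw
      S.pow (fun n ω i => randomWalk (n + 1) (t i) ω)
      (WienerSpace.ornsteinUhlenbeck c m hm) (fun w i => w (t i)) ∧
    ∀ f : (Fin p → ℝ) → ℝ, IsC1Lip f →
      Tendsto (fun n : ℕ => ∫ ω, S.pow.Γ (fun ω => f fun i => randomWalk (n + 1) (t i) ω)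
          (fun ω => f fun i => randomWalk (n + 1) (t i) ω) ω ∂S.pow.P) atTop
        (𝓝 (∫ w, ∑ i, ∑ j, partialDeriv f i (fun k => w (t k)) *
          partialDeriv f j (fun k => w (t k)) * (c * min (t i : ℝ) (t j : ℝ)) ∂m)) := by
  have hc0 : 0 ≤ c := hc ▸ integral_nonneg_of_ae (hS.gamma_nonneg _ hid)
  -- If the steps vanish, the Wiener measure is degenerate, and closability rests on `c = 0`.
  have hcv : (∫ x, x ^ 2 ∂S.P) ≠ 0 ∨ c = 0 :=
    or_iff_not_imp_left.2 fun h =>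
      hc.trans (ErrorData.integral_gamma_id_eq_zero hS hid (not_not.1 h))
  have henergy : ∀ f : (Fin p → ℝ) → ℝ, IsC1Lip f →
      Tendsto (fun n : ℕ => ∫ ω, S.pow.Γ (fun ω => f fun i => randomWalk (n + 1) (t i) ω)
          (fun ω => f fun i => randomWalk (n + 1) (t i) ω) ω ∂S.pow.P) atTop
        (𝓝 (∫ w, ∑ i, ∑ j, partialDeriv f i (fun k => w (t k)) *
          partialDeriv f j (fun k => w (t k)) * (c * min (t i : ℝ) (t j : ℝ)) ∂m)) := by
    intro f hf
    simp_rw [randomWalk_eq_linComb]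
    rw [hc]
    exact (tendsto_add_atTop_iff_nat 1).2
      (ErrorData.tendsto_integral_gamma_randomWalk hS hid hmean hm hW t hf)
  refine ⟨?_, henergy⟩
  exact
    { isErrorStructure := WienerSpace.isErrorStructure_ornsteinUhlenbeck hc0 hm hW hcv
      measurable_seq := fun n => by
        have h := measurable_linComb (fun i => walkCoeff (n + 1) (t i)) (n + 1 + 1)
        exact (funext fun ω => randomWalk_eq_linComb (n + 1) t ω : _ = _) ▸ h
      measurable_lim :=
        (continuous_pi fun i => ContinuousEvalConst.continuous_eval_const (t i)).measurable
      tendsto_law := fun f => by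
        simp_rw [randomWalk_eq_linComb]
        exact (tendsto_add_atTop_iff_nat 1).2
          (ErrorData.tendsto_integral_randomWalk hS hid hmean hm hW t f)
      mem_dom_seq := fun F hF n => by
        simp_rw [randomWalk_eq_linComb]
        exact ErrorData.linComb_mem_dom_pow hS hid
          (fun i k hk => walkCoeff_eq_zero (t i) hk) hF
      mem_dom_lim := fun F hF =>
        WienerSpace.eval_mem_dom_ornsteinUhlenbeck hc0 hm hW ⟨p, t, F, hF⟩
      tendsto_energy := fun F hF => by
        have h := WienerSpace.energy_ornsteinUhlenbeck_eval hc0 hm hW hcv ⟨p, t, F, hF⟩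
        exact ((henergy F hF).const_mul (1 / 2)).trans (congrArg 𝓝 h.symm).le }

end
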